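/- Let $(\Omega,\Sigma,\mu)$ be a nonatomic $\sigma$-finite measure space and let $P\colon\Omega\to(0,\infty]$ be measurable. Let $R(P)\subseteq[0,\infty]$ be its essential range, that is, the support of the image measure $P(\mu)$, and suppose that $P^-:=\min R(P)>0$. Let $\mathbb{F}$ be the real or complex field. Put $\Phi_p(t)=t^p$ for $0<p<\infty$ and $\Phi_\infty=\infty\,\chi_{(1,\infty)}$. The space $L_P$ consists of all (classes of) measurable $f\colon\Omega\to\mathbb{F}$ with $\int_\Omega \Phi_{P(\omega)}(t|f(\omega)|)\,d\mu(\omega)<\infty$ for some $t\in(0,\infty)$, with the quasi-norm $\|f\|_P=\inf\{t>0 : \int_\Omega\Phi_{P(\omega)}(|f(\omega)|/t)\,d\mu(\omega)<1\}$. An Orlicz function is a non-decreasing left-continuous function $F\colon[0,\infty)\to[0,\infty]$ with $\lim_{t\to0^+}F(t)=0$ and $\lim_{t\to\infty}F(t)>0$. The Orlicz sequence space $\ell_F$ consists of all $a\in\mathbb{F}^{\mathbb{N}}$ with $\sum_n F(t|a_n|)<\infty$ for some $t\in(0,\infty)$, with the vector topology for which the sets $\{a : \sum_n F(|a_n|/u)<\varepsilon\}$,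 $u,\varepsilon\in(0,\infty)$, form a neighbourhood basis at $0$. For nonempty $R\subseteq(0,\infty]$ let $\mathcal{K}(R)$ be the closed convex hull in $C([0,1])$ of $\{\psi_p : p\in R\}$, where $\psi_p(t)=t^p/p$ for $p<\infty$ and $\psi_\infty=0$. Let $\mathcal{O}(R)$ be the set of all Orlicz functions $F$ for which there are $0<c\le1$, $\varphi\in\mathcal{K}(R)$ and constants $A,B\in(0,\infty)$ with $A\varphi(t)\le F(t)\le B\varphi(t)$ for $0\le t\le c$. A sequence space is a quasi-Banach lattice $\mathbb{S}\subseteq\mathbb{F}^{\mathbb{N}}$ (if $f\in\mathbb{S}$ and $|g|\le|f|$, then $g\in\mathbb{S}$ and $\|g\|\le\|f\|$) whose coordinate functionals are continuous, which contains the unit vectors $e_n$, and for which there is a constant $C$ such that, whenever $f_k\in\mathbb{S}$ converge coordinatewise to $f$ and $s:=\limsup_k\|f_k\|<\infty$, we have $f\in\mathbb{S}$ and $\|f\|\le Cs$. It is subsymmetric if, for every strictly increasing $\pi\colon\mathbb{N}\to\mathbb{N}$, the map $(a_n)_n\mapsto(a_{\pi(n)})_n$ is an isometry from $\{f\in\mathbb{S}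 : \operatorname{supp} f\subseteq\pi(\mathbb{N})\}$ onto $\mathbb{S}$. It disjointly embeds into $L_P$ if there is a linear map $T\colon\mathbb{S}\to L_P$ that is an isomorphism onto its image (as a map between quasi-normed spaces) and for which the functions $T(e_n)$, $n\in\mathbb{N}$, are pairwise disjointly supported up to null sets. Let $\mathbb{S}$ be a subsymmetric sequence space. Then the following are equivalent: 1. $\mathbb{S}$ disjointly embeds into $L_P$; 2. $\mathbb{S}=\ell_F$, with the same topology, for some $F\in\mathcal{O}(R(P))$. -/

import Mathlib

open MeasureTheory Filter Topology
open scoped NNReal ENNReal unitInterval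

namespace VarExp

/-! ### Musielak-Orlicz spaces -/

/-- An Orlicz function: a non-decreasing left-continuous `F : [0,∞) → [0,∞]` with
`F(t) → 0` as `t → 0⁺` and `lim_{t → ∞} F(t) > 0`. The value `∞` is allowed. -/
structure IsOrlicz (F : ℝ≥0 → ℝ≥0∞) : Prop where
  mono : Monotone F
  left_cont : ∀ t, ContinuousWithinAt F (Set.Iic t) t
  tendsto_zero : Tendsto F (𝓝[>] 0) (𝓝 0)
  top_pos : ∃ L : ℝ≥0∞, 0 < L ∧ Tendsto F atTop (𝓝 L)

section MusielakOrlicz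

variable {Ω : Type*} [MeasurableSpace Ω]

/-- The modular `ρ_M(f) = ∫ M(ω, f(ω)) dμ(ω)`. -/
noncomputable def modular (M : Ω → ℝ≥0 → ℝ≥0∞) (μ : Measure Ω) (f : Ω → ℝ≥0) : ℝ≥0∞ :=
  ∫⁻ ω, M ω (f ω) ∂μ

/-- `f ∈ L_M` (for a measurable `f`): `ρ_M(t|f|) < ∞` for some `t ∈ (0,∞)`. -/
def MemMO {𝕜 : Type*} [RCLike 𝕜] (M : Ω → ℝ≥0 → ℝ≥0∞) (μ : Measure Ω) (f : Ω → 𝕜) : Prop :=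
  ∃ t : ℝ≥0, 0 < t ∧ modular M μ (fun ω => t * ‖f ω‖₊) < ∞

/-- The Luxemburg gauge `inf {t ∈ (0,∞) : ρ_M(|f|/t) < 1}`. -/
noncomputable def luxemburg {𝕜 : Type*} [RCLike 𝕜] (M : Ω → ℝ≥0 → ℝ≥0∞) (μ : Measure Ω)
    (f : Ω → 𝕜) : ℝ≥0∞ :=
  ⨅ (t : ℝ≥0) (_ : 0 < t) (_ : modular M μ (fun ω => ‖f ω‖₊ / t) < 1), (t : ℝ≥0∞)

end MusielakOrlicz

/-! ### Variable exponents -/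

/-- The power function `Φ_p(t) = t^p`, `p ∈ (0,∞]`, where `Φ_∞ = ∞ · χ_{(1,∞)}`. -/
noncomputable def powerFn (p : ℝ≥0∞) (t : ℝ≥0) : ℝ≥0∞ :=
  if p = ∞ then (if t ≤ 1 then 0 else ∞) else (t : ℝ≥0∞) ^ p.toReal

section Exponent

variable {Ω : Type*} [MeasurableSpace Ω]

/-- A variable exponent: a measurable function `P : Ω → (0,∞]`. -/
def IsVarExponent (P : Ω → ℝ≥0∞) : Prop := Measurable P ∧ ∀ ω, 0 < P ω

/-- The Musielak-Orlicz function `M_P(ω,t) = Φ_{P(ω)}(t)`; `L_P` is the space built from it. -/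
noncomputable def expMO (P : Ω → ℝ≥0∞) (ω : Ω) (t : ℝ≥0) : ℝ≥0∞ := powerFn (P ω) t

/-- The essential range `R(P) ⊆ [0,∞]`: the support of the image measure `P(μ)`. -/
noncomputable def essRange (P : Ω → ℝ≥0∞) (μ : Measure Ω) : Set ℝ≥0∞ := (μ.map P).support

/-- `P⁻ = min R(P)`. -/
noncomputable def expMinus (P : Ω → ℝ≥0∞) (μ : Measure Ω) : ℝ≥0∞ := sInf (essRange P μ)

/-- A nonatomic measure: every measurable set of positive measure has a measurable subset of
strictly smaller positive measure. -/
def IsNonatomic (μ : Measure Ω) : Prop :=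
  ∀ A, MeasurableSet A → 0 < μ A → ∃ B, B ⊆ A ∧ MeasurableSet B ∧ 0 < μ B ∧ μ B < μ A

end Exponent

/-! ### Orlicz functions generated near zero by power functions -/

/-- `ψ_p ∈ C([0,1])`, `ψ_p(t) = t^p / p` for `0 < p < ∞`, and `ψ_∞ = 0`. -/
noncomputable def psi (p : ℝ≥0∞) : C(I, ℝ) where
  toFun t := if p = ∞ then 0 else (t : ℝ) ^ p.toReal / p.toReal
  continuous_toFun := by
    by_cases h : p = ∞
    · simp only [h, if_true]; exact continuous_const
    · simp only [h, if_false]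
      exact ((Real.continuous_rpow_const ENNReal.toReal_nonneg).comp
        continuous_subtype_val).div_const _

/-- `𝒦(R)`: the closed convex hull in `C([0,1])` of `{ψ_p : p ∈ R}`. -/
noncomputable def convexPowers (R : Set ℝ≥0∞) : Set C(I, ℝ) :=
  closure (convexHull ℝ (psi '' R))

/-- `F ∈ 𝒪(R)`: `F` is an Orlicz function, and there are `0 < c ≤ 1` and `φ ∈ 𝒦(R)` such that
`F(t) ≈ φ(t)` for `0 ≤ t ≤ c`, that is, `A φ(t) ≤ F(t) ≤ B φ(t)` for some constants
`A, B ∈ (0,∞)`. -/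
def OrliczGen (R : Set ℝ≥0∞) (F : ℝ≥0 → ℝ≥0∞) : Prop :=
  IsOrlicz F ∧ ∃ c : ℝ, 0 < c ∧ c ≤ 1 ∧ ∃ φ ∈ convexPowers R,
    ∃ A B : ℝ, 0 < A ∧ 0 < B ∧ ∀ t : I, (t : ℝ) ≤ c →
      ENNReal.ofReal (A * φ t) ≤ F (unitInterval.toNNReal t) ∧
      F (unitInterval.toNNReal t) ≤ ENNReal.ofReal (B * φ t)

/-! ### Sequence spaces -/

/-- A sequence space, that is, a function space over `ℕ` with the counting measure: a
quasi-Banach lattice of scalar sequences that embeds continuously into the space of all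
sequences (where convergence in measure on finite sets is coordinatewise convergence), contains
all finitely supported sequences, and satisfies a weak Fatou property. -/
structure SequenceSpace (𝕜 : Type*) [RCLike 𝕜] where
  carrier : Submodule 𝕜 (ℕ → 𝕜)
  /-- the quasi-norm -/
  nrm : carrier → ℝ≥0
  nrm_eq_zero : ∀ f, nrm f = 0 → f = 0
  nrm_smul : ∀ (a : 𝕜) (f : carrier), nrm (a • f) = ‖a‖₊ * nrm f
  nrm_add : ∃ κ : ℝ≥0, ∀ f g, nrm (f + g) ≤ κ * (nrm f + nrm g)
  complete : ∀ u : ℕ → carrier,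
    (∀ ε : ℝ≥0, 0 < ε → ∃ K, ∀ j ≥ K, ∀ k ≥ K, nrm (u j - u k) < ε) →
    ∃ f, Tendsto (fun k => nrm (u k - f)) atTop (𝓝 0)
  lattice : ∀ (f : carrier) (g : ℕ → 𝕜), (∀ n, ‖g n‖ ≤ ‖(f : ℕ → 𝕜) n‖) →
    ∃ hg : g ∈ carrier, nrm ⟨g, hg⟩ ≤ nrm f
  coord_cont : ∀ n, ∃ C : ℝ≥0, ∀ f : carrier, ‖(f : ℕ → 𝕜) n‖₊ ≤ C * nrm f
  single_mem : ∀ n, (Pi.single n 1 : ℕ → 𝕜) ∈ carrier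
  fatou : ∃ C : ℝ≥0, ∀ (u : ℕ → carrier) (g : ℕ → 𝕜),
    (∀ n, Tendsto (fun k => (u k : ℕ → 𝕜) n) atTop (𝓝 (g n))) →
    limsup (fun k => (nrm (u k) : ℝ≥0∞)) atTop < ∞ →
    ∃ hg : g ∈ carrier,
      (nrm ⟨g, hg⟩ : ℝ≥0∞) ≤ C * limsup (fun k => (nrm (u k) : ℝ≥0∞)) atTop

namespace SequenceSpace

variable {𝕜 : Type*} [RCLike 𝕜]

/-- The unit vectors `e_n`. -/
noncomputable def unitVec (S : SequenceSpace 𝕜) (n : ℕ) : S.carrier :=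
  ⟨Pi.single n 1, S.single_mem n⟩

/-- `S` is subsymmetric: for every (strictly) increasing `π : ℕ → ℕ`, the map
`(a_n) ↦ (a_{π(n)})` is an isometry from `{f ∈ S : supp f ⊆ π(ℕ)}` onto `S`. -/
def IsSubsymmetric (S : SequenceSpace 𝕜) : Prop :=
  ∀ π : ℕ → ℕ, StrictMono π →
    (∀ f : S.carrier, Function.support (f : ℕ → 𝕜) ⊆ Set.range π →
      ∃ h : (fun n => (f : ℕ → 𝕜) (π n)) ∈ S.carrier, S.nrm ⟨_, h⟩ = S.nrm f) ∧
    (∀ g : S.carrier, ∃ f : S.carrier, Function.support (f : ℕ → 𝕜) ⊆ Set.range π ∧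
      ∀ n, (f : ℕ → 𝕜) (π n) = (g : ℕ → 𝕜) n)

/-- `S` disjointly embeds into `L_P(μ)`: there is a linear map `T : S → L_P(μ)` that is an
isomorphism onto its image and for which the functions `T(e_n)` are pairwise disjointly
supported. Here `P⁻ > 0`, so the Luxemburg gauge is a quasi-norm inducing the topology of
`L_P(μ)`. -/
def DisjointlyEmbeds (S : SequenceSpace 𝕜) {Ω : Type*} [MeasurableSpace Ω] (μ : Measure Ω)
    (P : Ω → ℝ≥0∞) : Prop :=
  ∃ T : S.carrier →ₗ[𝕜] (Ω →ₘ[μ] 𝕜),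
    (∀ a, MemMO (expMO P) μ (T a)) ∧
    (∃ C : ℝ≥0, ∀ a, luxemburg (expMO P) μ (T a) ≤ C * S.nrm a ∧
      (S.nrm a : ℝ≥0∞) ≤ C * luxemburg (expMO P) μ (T a)) ∧
    ∀ m n, m ≠ n → ∀ᵐ ω ∂μ, T (S.unitVec m) ω = 0 ∨ T (S.unitVec n) ω = 0

/-- `S = ℓ_F` as topological vector spaces: the underlying sets agree, and so do the topology
given by the quasi-norm of `S` and the vector topology of `ℓ_F`, for which the sets
`u B_F(ε) = {a : ρ_F(|a|/u) < ε}`, `u, ε ∈ (0,∞)`, are a neighbourhood basis at the origin. -/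
def EqOrliczSpace (S : SequenceSpace 𝕜) (F : ℝ≥0 → ℝ≥0∞) : Prop :=
  (∀ a : ℕ → 𝕜, a ∈ S.carrier ↔ MemMO (fun _ => F) Measure.count a) ∧
  (∀ u ε : ℝ≥0, 0 < u → 0 < ε → ∃ δ : ℝ≥0, 0 < δ ∧ ∀ a : S.carrier, S.nrm a < δ →
    modular (fun _ => F) Measure.count (fun n => ‖(a : ℕ → 𝕜) n‖₊ / u) < ε) ∧
  (∀ δ : ℝ≥0, 0 < δ → ∃ u ε : ℝ≥0, 0 < u ∧ 0 < ε ∧ ∀ a : S.carrier,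
    modular (fun _ => F) Measure.count (fun n => ‖(a : ℕ → 𝕜) n‖₊ / u) < ε → S.nrm a < δ)

end SequenceSpace

end VarExp

/-! If `f_n` are disjointly supported, the modular of `∑ a_n f_n` in `L_P` is `∑ G_n(|a_n|)` with
`G_n(t) = ∫ Φ_P(t|f_n|) dμ`. So a disjoint embedding means that, up to dilations, the unit ball of
`S` is the unit ball of such a modular (`IsModular`). As `P⁻ > 0`, every modular here satisfies
`H(st) ≤ s^m H(t)` for `s ≤ 1`, so a dilation turns any finite bound into a small one.

From an embedding to an Orlicz space: subsymmetry gives all `e_n` the same norm, hence `G_n(b) ≤ 1 <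
G_n(B)` with `b, B` independent of `n`. Since `(t/e)^p = (t^p/p) · p e^{-p}`, the function `t ↦
G_n(b e⁻¹ t)` is `s_n k_n`, where `k_n ∈ 𝒦(R)` is essentially a mean of the `ψ_p` and `s_n` stays in
a fixed interval `[τ, 1]` (`exists_dilatedModular_eq`). The map `1/p ↦ ψ_p` is Lipschitz up to `p =
∞`, so `𝒦(R)` is compact and a subsequence of `k_n` converges to some `k` with errors `2⁻ⁿ`.
Summable errors do not change the space (`modLE_orliczOf_of_approx`), nor does passing to a
subsequence of a subsymmetric basis.

Conversely, given `k ∈ 𝒦(R)`, nonatomicity splits `Ω` into countably many pieces, each of which sees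
all of `R(P)` (`IsNonatomic.exists_partition`). On the `n`-th piece some probability density `h` has
`∫ ψ_P(t) h` within `2⁻ⁿ` of `k(t)`. Solving `Φ_P(t g) = ψ_P(t) h` gives `g`, and `a ↦ a_n g` on the
`n`-th piece is the embedding. -/

namespace VarExp

/-! ### Power functions -/

lemma powerFn_top (t : ℝ≥0) : powerFn ∞ t = if t ≤ 1 then 0 else ∞ := by simp [powerFn]

lemma powerFn_of_ne_top {p : ℝ≥0∞} (hp : p ≠ ∞) (t : ℝ≥0) :
    powerFn p t = (t : ℝ≥0∞) ^ p.toReal := by simp [powerFn, hp]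

lemma powerFn_mono (p : ℝ≥0∞) : Monotone (powerFn p) := by
  intro s t h
  by_cases hp : p = ∞
  · subst hp
    rw [powerFn_top, powerFn_top]
    by_cases h2 : t ≤ 1
    · simp [h2, h.trans h2]
    · simp [h2]
  · rw [powerFn_of_ne_top hp, powerFn_of_ne_top hp]
    exact ENNReal.rpow_le_rpow (by exact_mod_cast h) ENNReal.toReal_nonneg

lemma powerFn_zero {p : ℝ≥0∞} (hp : 0 < p) : powerFn p 0 = 0 := by
  by_cases h : p = ∞
  · simp [h, powerFn_top]
  · rw [powerFn_of_ne_top h]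
    simp [ENNReal.toReal_pos hp.ne' h]

/-- For `p ≥ m` and `s ≤ 1`, `s^p ≤ s^m`. This is the only way in which `P⁻ > 0` controls the
modulars, and it replaces convexity. -/
lemma powerFn_mul_le {p : ℝ≥0∞} {m : ℝ} (hm : 0 < m) (hp : ENNReal.ofReal m ≤ p) {s : ℝ≥0}
    (hs : s ≤ 1) (t : ℝ≥0) : powerFn p (s * t) ≤ (s : ℝ≥0∞) ^ m * powerFn p t := by
  have hp0 : 0 < p := (ENNReal.ofReal_pos.2 hm).trans_le hp
  rcases eq_or_ne s 0 with rfl | hs0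
  · simp [powerFn_zero hp0, hm]
  by_cases h : p = ∞
  · subst h
    rw [powerFn_top, powerFn_top]
    split_ifs with h1 h2 h2
    · simp
    · simp
    · exact absurd (mul_le_one₀ hs zero_le h2) h1
    · rw [ENNReal.mul_top]
      simp [hs0]
  · rw [powerFn_of_ne_top h, powerFn_of_ne_top h, ENNReal.coe_mul,
      ENNReal.mul_rpow_of_nonneg _ _ ENNReal.toReal_nonneg]
    refine mul_le_mul' ?_ le_rfl
    refine ENNReal.rpow_le_rpow_of_exponent_ge (ENNReal.coe_le_one_iff.2 hs) ?_
    exact (ENNReal.ofReal_le_iff_le_toReal h).1 hp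

lemma measurable_powerFn {α : Type*} [MeasurableSpace α] {P : α → ℝ≥0∞} {f : α → ℝ≥0}
    (hP : Measurable P) (hf : Measurable f) : Measurable fun ω => powerFn (P ω) (f ω) := by
  unfold powerFn
  refine Measurable.ite (hP (measurableSet_singleton _)) ?_ ?_
  · exact Measurable.ite (measurableSet_le hf measurable_const) measurable_const measurable_const
  · exact hf.coe_nnreal_ennreal.pow hP.ennreal_toReal

/-! ### The functions `psi p` and the set they generate -/

lemma psi_top (t : I) : psi ∞ t = 0 := by simp [psi]

lemma psi_of_ne_top {p : ℝ≥0∞} (hp : p ≠ ∞) (t : I) :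
    psi p t = (t : ℝ) ^ p.toReal / p.toReal := by simp [psi, hp]

lemma psi_nonneg (p : ℝ≥0∞) (t : I) : 0 ≤ psi p t := by
  by_cases hp : p = ∞
  · rw [hp, psi_top]
  · rw [psi_of_ne_top hp]
    exact div_nonneg (Real.rpow_nonneg t.2.1 _) ENNReal.toReal_nonneg

lemma psi_mul_le {p : ℝ≥0∞} {m : ℝ} (hp : ENNReal.ofReal m ≤ p) (s t : I) (hs : 0 < (s : ℝ)) :
    psi p (s * t) ≤ (s : ℝ) ^ m * psi p t := by
  by_cases h : p = ∞
  · simp [h, psi_top]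
  · rw [psi_of_ne_top h, psi_of_ne_top h, Set.Icc.coe_mul, Real.mul_rpow s.2.1 t.2.1,
      mul_div_assoc]
    exact mul_le_mul_of_nonneg_right (Real.rpow_le_rpow_of_exponent_ge hs s.2.2
      ((ENNReal.ofReal_le_iff_le_toReal h).1 hp))
      (div_nonneg (Real.rpow_nonneg t.2.1 _) ENNReal.toReal_nonneg)

/-- The difference is largest at `t = 1`: Bernoulli's inequality for `x = t^p` and the exponent `q/p
≥ 1` gives `t^q ≥ 1 + (q/p)(t^p - 1)`, which is then divided by `q`. -/
lemma rpow_div_sub_le {t p q : ℝ} (ht0 : 0 ≤ t) (ht1 : t ≤ 1) (hp : 0 < p) (hpq : p ≤ q) :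
    |t ^ p / p - t ^ q / q| ≤ 1 / p - 1 / q := by
  have hq : 0 < q := hp.trans_le hpq
  have h1 : t ^ q / q ≤ t ^ p / p := by
    rcases ht0.eq_or_lt with rfl | h0
    · simp [Real.zero_rpow, hp.ne', hq.ne']
    · exact div_le_div₀ (Real.rpow_nonneg ht0 _) (Real.rpow_le_rpow_of_exponent_ge h0 ht1 hpq)
        hp hpq
  rw [abs_of_nonneg (by linarith)]
  have h0 : 0 ≤ t ^ p := Real.rpow_nonneg ht0 _
  have hb := one_add_mul_self_le_rpow_one_add (s := t ^ p - 1) (by linarith)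
    (p := q / p) ((one_le_div hp).2 hpq)
  rw [add_sub_cancel, ← Real.rpow_mul ht0, mul_div_cancel₀ _ hp.ne'] at hb
  have h2 : (1 + q / p * (t ^ p - 1)) / q ≤ t ^ q / q := by gcongr
  have h3 : (1 + q / p * (t ^ p - 1)) / q = 1 / q + (t ^ p / p - 1 / p) := by field_simp
  linarith

lemma norm_psi_sub_le_of_le {p q : ℝ≥0∞} (hp : 0 < p) (hpq : p ≤ q) :
    ‖psi p - psi q‖ ≤ p⁻¹.toReal - q⁻¹.toReal := by
  have hinv : q⁻¹.toReal ≤ p⁻¹.toReal :=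
    ENNReal.toReal_mono (ENNReal.inv_ne_top.2 hp.ne') (ENNReal.inv_le_inv.2 hpq)
  rw [ContinuousMap.norm_le _ (by linarith)]
  intro t
  rw [ContinuousMap.sub_apply, Real.norm_eq_abs, ENNReal.toReal_inv, ENNReal.toReal_inv]
  by_cases hpt : p = ∞
  · have : q = ∞ := top_le_iff.1 (hpt ▸ hpq)
    simp [hpt, this]
  have hp' := ENNReal.toReal_pos hp.ne' hpt
  by_cases hqt : q = ∞
  · rw [hqt, psi_top, psi_of_ne_top hpt, sub_zero, ENNReal.toReal_top, inv_zero, sub_zero,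
      abs_of_nonneg (div_nonneg (Real.rpow_nonneg t.2.1 _) hp'.le), ← one_div]
    gcongr
    exact Real.rpow_le_one t.2.1 t.2.2 hp'.le
  · rw [psi_of_ne_top hpt, psi_of_ne_top hqt, ← one_div, ← one_div]
    exact rpow_div_sub_le t.2.1 t.2.2 hp' (ENNReal.toReal_mono hqt hpq)

lemma norm_psi_sub_le {p q : ℝ≥0∞} (hp : 0 < p) (hq : 0 < q) :
    ‖psi p - psi q‖ ≤ |p⁻¹.toReal - q⁻¹.toReal| := by
  rcases le_total p q with h | h
  · exact (norm_psi_sub_le_of_le hp h).trans (le_abs_self _)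
  · rw [norm_sub_rev, abs_sub_comm]
    exact (norm_psi_sub_le_of_le hq h).trans (le_abs_self _)

/-- The functions `psi p` parametrized by `x = 1 / p`. -/
noncomputable def psiInv (x : ℝ) : C(I, ℝ) := psi (ENNReal.ofReal x)⁻¹

/-- For `x ≤ 0` the function is `ψ_∞ = 0`, so `psiInv` depends only on `max x 0`. The parameter
`1/p` makes `p = ∞` an ordinary point. -/
lemma lipschitzWith_psiInv : LipschitzWith 1 psiInv := by
  refine LipschitzWith.of_dist_le_mul fun x y => ?_
  rw [NNReal.coe_one, one_mul, dist_eq_norm, Real.dist_eq]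
  refine (norm_psi_sub_le (by simp) (by simp)).trans ?_
  rw [inv_inv, inv_inv, ENNReal.toReal_ofReal', ENNReal.toReal_ofReal']
  exact abs_max_sub_max_le_abs x y 0

lemma psi_eq_psiInv {p : ℝ≥0∞} (hp : 0 < p) : psi p = psiInv p⁻¹.toReal := by
  rw [psiInv, ENNReal.ofReal_toReal (ENNReal.inv_ne_top.2 hp.ne'), inv_inv]

lemma norm_psi_le {p : ℝ≥0∞} (hp : 0 < p) : ‖psi p‖ ≤ p⁻¹.toReal := by
  have h := norm_psi_sub_le_of_le hp le_top
  have h0 : psi ∞ = 0 := by ext t; simp [psi_top]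
  simpa [h0] using h

lemma inv_toReal_le {p : ℝ≥0∞} {m : ℝ} (hm : 0 < m) (hp : ENNReal.ofReal m ≤ p) :
    p⁻¹.toReal ≤ m⁻¹ := by
  rw [← ENNReal.toReal_ofReal (inv_nonneg.2 hm.le), ENNReal.ofReal_inv_of_pos hm]
  exact ENNReal.toReal_mono (by simp [hm]) (ENNReal.inv_le_inv.2 hp)

/-- The generators lie in the continuous image of the compact interval `[0, 1/m]`, and convex hulls
preserve total boundedness. -/
lemma isCompact_convexPowers {R : Set ℝ≥0∞} {m : ℝ} (hm : 0 < m)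
    (hR : ∀ p ∈ R, ENNReal.ofReal m ≤ p) : IsCompact (convexPowers R) := by
  refine TotallyBounded.isCompact_of_isClosed ?_ isClosed_closure
  refine TotallyBounded.closure (totallyBounded_convexHull.2 ?_)
  refine TotallyBounded.subset ?_
    ((isCompact_Icc (a := (0 : ℝ)) (b := m⁻¹)).image lipschitzWith_psiInv.continuous).totallyBounded
  rintro _ ⟨p, hp, rfl⟩
  have hp' := hR p hp
  have hp0 : 0 < p := (ENNReal.ofReal_pos.2 hm).trans_le hp'
  exact ⟨p⁻¹.toReal, ⟨ENNReal.toReal_nonneg, inv_toReal_le hm hp'⟩, (psi_eq_psiInv hp0).symm⟩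

lemma measurable_psi_comp {α : Type*} [MeasurableSpace α] {P : α → ℝ≥0∞} (hP : Measurable P)
    (t : I) : Measurable fun ω => psi (P ω) t := by
  have h : ∀ ω, psi (P ω) t =
      if P ω = ∞ then 0 else (t : ℝ) ^ (P ω).toReal / (P ω).toReal := fun ω => rfl
  simp_rw [h]
  refine Measurable.ite (hP (measurableSet_singleton _)) measurable_const ?_
  exact (measurable_const.pow hP.ennreal_toReal).div hP.ennreal_toReal

/-- The non-negative functions on `[0,1]` that satisfy `k (s t) ≤ s ^ m k t`. -/
def PowerBounded (m : ℝ) (k : C(I, ℝ)) : Prop :=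
  (∀ t, 0 ≤ k t) ∧ ∀ s t : I, 0 < (s : ℝ) → k (s * t) ≤ (s : ℝ) ^ m * k t

/-- The defining inequalities hold for each `ψ_p` and are preserved by convex combinations and
pointwise limits. -/
lemma powerBounded_of_mem_convexPowers {R : Set ℝ≥0∞} {m : ℝ}
    (hR : ∀ p ∈ R, ENNReal.ofReal m ≤ p) {k : C(I, ℝ)} (hk : k ∈ convexPowers R) :
    PowerBounded m k := by
  have hconv : Convex ℝ {k | PowerBounded m k} := by
    intro f hf g hg a b ha hb _
    refine ⟨fun t => ?_, fun s t hs => ?_⟩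
    · simpa using add_nonneg (mul_nonneg ha (hf.1 t)) (mul_nonneg hb (hg.1 t))
    · have h1 := mul_le_mul_of_nonneg_left (hf.2 s t hs) ha
      have h2 := mul_le_mul_of_nonneg_left (hg.2 s t hs) hb
      simp only [ContinuousMap.add_apply, ContinuousMap.smul_apply, smul_eq_mul]
      linarith
  have hclosed : IsClosed {k | PowerBounded m k} := by
    simp only [PowerBounded, Set.ofPred_and, Set.ofPred_forall]
    refine IsClosed.inter (isClosed_iInter fun t => ?_) (isClosed_iInter fun s =>
      isClosed_iInter fun t => isClosed_iInter fun _ => ?_)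
    · exact isClosed_le continuous_const (continuous_eval_const t)
    · exact isClosed_le (continuous_eval_const _)
        (continuous_const.mul (continuous_eval_const t))
  refine closure_minimal (convexHull_min ?_ hconv) hclosed hk
  rintro _ ⟨p, hp, rfl⟩
  exact ⟨psi_nonneg p, fun s t hs => psi_mul_le (hR p hp) s t hs⟩

/-! ### Comparison of modulars on sequences -/

/-- `H (s t) ≤ s ^ m H t` for `s ≤ 1`. -/
def PowerScaled (m : ℝ) (H : ℝ≥0 → ℝ≥0∞) : Prop :=
  ∀ s t : ℝ≥0, s ≤ 1 → H (s * t) ≤ (s : ℝ≥0∞) ^ m * H t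

lemma exists_rpow_mul_lt {m : ℝ} (hm : 0 < m) {M ε : ℝ≥0∞} (hM : M ≠ ∞) (hε : ε ≠ 0) :
    ∃ s : ℝ≥0, 0 < s ∧ s ≤ 1 ∧ (s : ℝ≥0∞) ^ m * M < ε := by
  have h : Tendsto (fun s : ℝ≥0 => (s : ℝ≥0∞) ^ m * M) (𝓝[>] 0) (𝓝 0) := by
    have h1 : Tendsto (fun s : ℝ≥0 => (s : ℝ≥0∞) ^ m) (𝓝 0) (𝓝 0) := by
      have h2 : Continuous fun s : ℝ≥0 => (s : ℝ≥0∞) ^ m :=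
        ENNReal.continuous_rpow_const.comp ENNReal.continuous_coe
      simpa [hm] using h2.tendsto 0
    simpa using (ENNReal.Tendsto.mul_const h1 (Or.inr hM)).mono_left nhdsWithin_le_nhds
  have h1 : ∀ᶠ s : ℝ≥0 in 𝓝[>] 0, (s : ℝ≥0∞) ^ m * M < ε :=
    h.eventually_lt_const (pos_iff_ne_zero.2 hε)
  have h2 : ∀ᶠ s : ℝ≥0 in 𝓝[>] 0, s ≤ 1 :=
    nhdsWithin_le_nhds (Iic_mem_nhds zero_lt_one)
  obtain ⟨s, ⟨hs, hs1⟩, hs2⟩ := ((eventually_mem_nhdsWithin.and h2).and h1).exists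
  exact ⟨s, hs, hs1, hs2⟩

lemma PowerScaled.le {m : ℝ} (hm : 0 < m) {H : ℝ≥0 → ℝ≥0∞} (hH : PowerScaled m H)
    {s t : ℝ≥0} (h : s ≤ t) : H s ≤ H t := by
  rcases eq_or_ne t 0 with rfl | ht
  · rw [nonpos_iff_eq_zero.1 h]
  have h1 := hH (s / t) t (div_le_one_of_le₀ h zero_le)
  rw [div_mul_cancel₀ _ ht] at h1
  refine h1.trans (mul_le_of_le_one_left' ?_)
  exact ENNReal.rpow_le_one (ENNReal.coe_le_one_iff.2 (div_le_one_of_le₀ h zero_le)) hm.le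

lemma PowerScaled.zero {m : ℝ} (hm : 0 < m) {H : ℝ≥0 → ℝ≥0∞} (hH : PowerScaled m H) :
    H 0 = 0 := by
  simpa [hm] using hH 0 0 zero_le_one

lemma tsum_mul_le_of_powerScaled {m : ℝ} {H : ℕ → ℝ≥0 → ℝ≥0∞}
    (hH : ∀ n, PowerScaled m (H n)) {s : ℝ≥0} (hs : s ≤ 1) (x : ℕ → ℝ≥0) :
    ∑' n, H n (s * x n) ≤ (s : ℝ≥0∞) ^ m * ∑' n, H n (x n) := by
  rw [← ENNReal.tsum_mul_left]
  exact ENNReal.tsum_le_tsum fun n => hH n s (x n) hs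

/-- Up to a dilation, the unit ball of the modular of `G` is contained in that of `H`. -/
def ModLE (G H : ℕ → ℝ≥0 → ℝ≥0∞) : Prop :=
  ∃ c : ℝ≥0, 0 < c ∧ ∀ x : ℕ → ℝ≥0, ∑' n, G n (x n) ≤ 1 → ∑' n, H n (c * x n) ≤ 1

/-- Any finite bound `M` is as good as `1`: a further dilation by `s` with `s^m M < 1` removes it.
-/
lemma modLE_of_le {m : ℝ} (hm : 0 < m) {G H : ℕ → ℝ≥0 → ℝ≥0∞}
    (hH : ∀ n, PowerScaled m (H n)) {c : ℝ≥0} (hc : 0 < c) {M : ℝ≥0∞} (hM : M ≠ ∞)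
    (h : ∀ x : ℕ → ℝ≥0, ∑' n, G n (x n) ≤ 1 → ∑' n, H n (c * x n) ≤ M) : ModLE G H := by
  obtain ⟨s, hs0, hs1, hs⟩ := exists_rpow_mul_lt hm hM one_ne_zero
  refine ⟨s * c, mul_pos hs0 hc, fun x hx => ?_⟩
  simp_rw [mul_assoc]
  refine (tsum_mul_le_of_powerScaled hH hs1 _).trans (le_trans ?_ hs.le)
  gcongr
  exact h x hx

/-- The Orlicz function that is `k` on `[0,1]` and `∞` on `(1,∞)`. -/
noncomputable def orliczOf (k : C(I, ℝ)) (t : ℝ≥0) : ℝ≥0∞ :=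
  if h : t ≤ 1 then ENNReal.ofReal (k ⟨t, t.2, h⟩) else ∞

lemma orliczOf_toNNReal (k : C(I, ℝ)) (t : I) :
    orliczOf k (unitInterval.toNNReal t) = ENNReal.ofReal (k t) := by
  have h : unitInterval.toNNReal t ≤ 1 := t.2.2
  rw [orliczOf, dif_pos h]
  rfl

lemma exists_toNNReal_eq {t : ℝ≥0} (ht : t ≤ 1) : ∃ u : I, unitInterval.toNNReal u = t :=
  ⟨⟨t, t.2, ht⟩, rfl⟩

lemma orliczOf_of_one_lt (k : C(I, ℝ)) {t : ℝ≥0} (ht : 1 < t) : orliczOf k t = ∞ := by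
  rw [orliczOf, dif_neg ht.not_ge]

lemma PowerBounded.powerScaled {m : ℝ} (hm : 0 < m) {k : C(I, ℝ)} (hk : PowerBounded m k) :
    PowerScaled m (orliczOf k) := by
  intro s t hs
  -- The scaling of `k` is only assumed for `s > 0`; at `t = 0` it reads `k 0 ≤ s^m k 0`, and `s →
  -- 0⁺`.
  have hk0 : k 0 = 0 := by
    have hlim : Tendsto (fun s : ℝ => s ^ m * k 0) (𝓝[>] 0) (𝓝 0) := by
      have h2 := ((Real.continuous_rpow_const hm.le).tendsto 0).mul_const (k 0)
      simp only [Real.zero_rpow hm.ne', zero_mul] at h2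
      exact h2.mono_left nhdsWithin_le_nhds
    refine le_antisymm (ge_of_tendsto hlim ?_) (hk.1 0)
    filter_upwards [Ioc_mem_nhdsGT (zero_lt_one' ℝ)] with s hs
    simpa using hk.2 ⟨s, hs.1.le, hs.2⟩ 0 hs.1
  rcases eq_or_ne s 0 with rfl | hs0
  · have := orliczOf_toNNReal k 0
    simp only [unitInterval.toNNReal_zero, hk0, ENNReal.ofReal_zero] at this
    simp [this]
  rcases le_or_gt t 1 with ht | ht
  · obtain ⟨u, rfl⟩ := exists_toNNReal_eq hs
    obtain ⟨v, rfl⟩ := exists_toNNReal_eq ht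
    have h : unitInterval.toNNReal u * unitInterval.toNNReal v = unitInterval.toNNReal (u * v) :=
      rfl
    have hu : 0 < (u : ℝ) := NNReal.coe_pos.2 (pos_iff_ne_zero.2 hs0)
    rw [h, orliczOf_toNNReal, orliczOf_toNNReal]
    have h1 : ((unitInterval.toNNReal u : ℝ≥0) : ℝ≥0∞) = ENNReal.ofReal u := by
      rw [ENNReal.ofReal, ← unitInterval.coe_toNNReal, Real.toNNReal_coe]
    rw [h1, ENNReal.ofReal_rpow_of_pos hu, ← ENNReal.ofReal_mul (Real.rpow_nonneg hu.le _)]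
    exact ENNReal.ofReal_le_ofReal (hk.2 u v hu)
  · rw [orliczOf_of_one_lt k ht, ENNReal.mul_top]
    · exact le_top
    · simp [hs0]

/-- The value `∞` beyond `1` makes the limit at infinity positive even for `k = 0`, when the
function is `Φ_∞`. -/
lemma isOrlicz_orliczOf {m : ℝ} (hm : 0 < m) {k : C(I, ℝ)} (hk : PowerBounded m k) :
    IsOrlicz (orliczOf k) where
  mono _ _ h := (hk.powerScaled hm).le hm h
  left_cont t := by
    rcases le_or_gt t 1 with ht | ht
    · have hc : ContinuousOn (orliczOf k) (Set.Iic 1) := by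
        have h1 : Continuous fun u : Set.Iic (1 : ℝ≥0) =>
            ENNReal.ofReal (k ⟨u.1, u.1.2, u.2⟩) :=
          ENNReal.continuous_ofReal.comp (k.continuous.comp (by fun_prop))
        rw [continuousOn_iff_continuous_domRestrict]
        convert h1 using 2 with u
        have hu : (u : ℝ≥0) ≤ 1 := u.2
        simp [orliczOf, hu]
      exact (hc t ht).mono (Set.Iic_subset_Iic.2 ht)
    · refine (continuousWithinAt_const (b := (∞ : ℝ≥0∞))).congr_of_eventuallyEq ?_
        (orliczOf_of_one_lt k ht)
      filter_upwards [nhdsWithin_le_nhds (Ioi_mem_nhds ht)] with u hu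
      exact orliczOf_of_one_lt k hu
  tendsto_zero := by
    have h1 : ∀ᶠ s : ℝ≥0 in 𝓝[>] 0, orliczOf k s ≤ (s : ℝ≥0∞) ^ m * orliczOf k 1 := by
      have h2 : ∀ᶠ s : ℝ≥0 in 𝓝[>] 0, s ≤ 1 :=
        nhdsWithin_le_nhds (Iic_mem_nhds zero_lt_one)
      filter_upwards [h2] with s hs
      simpa using hk.powerScaled hm s 1 hs
    refine tendsto_of_tendsto_of_tendsto_of_le_of_le' tendsto_const_nhds ?_
      (Eventually.of_forall fun _ => zero_le) h1
    have h2 : Continuous fun s : ℝ≥0 => (s : ℝ≥0∞) ^ m :=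
      ENNReal.continuous_rpow_const.comp ENNReal.continuous_coe
    have h3 : Tendsto (fun s : ℝ≥0 => (s : ℝ≥0∞) ^ m) (𝓝[>] 0) (𝓝 0) := by
      simpa [hm] using (h2.tendsto 0).mono_left nhdsWithin_le_nhds
    have h4 : orliczOf k 1 ≠ ∞ := by simp [orliczOf]
    simpa using ENNReal.Tendsto.mul_const h3 (Or.inr h4)
  top_pos := by
    refine ⟨∞, by simp, tendsto_const_nhds.congr' ?_⟩
    filter_upwards [eventually_gt_atTop 1] with t ht
    exact (orliczOf_of_one_lt k ht).symm

lemma orliczGen_orliczOf {m : ℝ} (hm : 0 < m) {R : Set ℝ≥0∞}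
    (hR : ∀ p ∈ R, ENNReal.ofReal m ≤ p) {k : C(I, ℝ)} (hk : k ∈ convexPowers R) :
    OrliczGen R (orliczOf k) :=
  ⟨isOrlicz_orliczOf hm (powerBounded_of_mem_convexPowers hR hk), 1, one_pos, le_rfl, k, hk, 1, 1,
    one_pos, one_pos, fun t _ => by simp [orliczOf_toNNReal]⟩

lemma ofReal_two_inv_pow (n : ℕ) : ENNReal.ofReal (2⁻¹ ^ n) = 2⁻¹ ^ n := by
  rw [ENNReal.ofReal_pow (by norm_num), ENNReal.ofReal_inv_of_pos two_pos, ENNReal.ofReal_ofNat]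

lemma tsum_two_inv_pow : ∑' n : ℕ, (2⁻¹ : ℝ≥0∞) ^ n = 2 := by
  rw [ENNReal.tsum_geometric, ENNReal.one_sub_inv_two, inv_inv]

/-- If the functions `G n` agree near zero with `k` up to a constant factor and a summable error,
then they define the same sequence space as `orliczOf k`. -/
lemma modLE_orliczOf_of_approx {m : ℝ} (hm : 0 < m) {G : ℕ → ℝ≥0 → ℝ≥0∞}
    (hG : ∀ n, PowerScaled m (G n)) {k : C(I, ℝ)} (hk : PowerBounded m k) {B β : ℝ≥0}
    (hB : ∀ n, 1 < G n B) (hβ : 0 < β) {D : ℝ≥0∞} (hD : D ≠ ∞)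
    (hle : ∀ n t, G n (β * unitInterval.toNNReal t) ≤ ENNReal.ofReal (k t) + 2⁻¹ ^ n)
    (hge : ∀ n t,
      ENNReal.ofReal (k t) ≤ D * G n (β * unitInterval.toNNReal t) + 2⁻¹ ^ n) :
    ModLE G (fun _ => orliczOf k) ∧ ModLE (fun _ => orliczOf k) G := by
  constructor
  · have hB0 : 0 < B := by
      refine pos_iff_ne_zero.2 fun h => ?_
      have := hB 0
      simp [h, (hG 0).zero hm] at this
    -- The bound `B⁻¹` keeps `c x_n` in `[0,1]`, because a modular at most `1` forces `x_n ≤ B`; the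
    -- bound `β⁻¹` ensures `β c x_n ≤ x_n`.
    set c : ℝ≥0 := min β⁻¹ B⁻¹ with hc
    refine modLE_of_le hm (fun _ => hk.powerScaled hm) (c := c)
      (lt_min (inv_pos.2 hβ) (inv_pos.2 hB0)) (M := D * 1 + 2)
      (ENNReal.add_ne_top.2 ⟨ENNReal.mul_ne_top hD ENNReal.one_ne_top, by simp⟩) fun x hx => ?_
    have hxn : ∀ n, orliczOf k (c * x n) ≤ D * G n (x n) + 2⁻¹ ^ n := by
      intro n
      have hxB : x n ≤ B := by
        by_contra! h
        exact absurd ((((hG n).le hm h.le).trans (ENNReal.le_tsum n)).trans hx) (hB n).not_ge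
      have h1 : c * x n ≤ 1 := by
        calc c * x n ≤ B⁻¹ * B := by gcongr; exact min_le_right _ _
          _ = 1 := inv_mul_cancel₀ hB0.ne'
      obtain ⟨t, ht⟩ := exists_toNNReal_eq h1
      rw [← ht, orliczOf_toNNReal]
      refine (hge n t).trans ?_
      gcongr
      refine (hG n).le hm ?_
      rw [ht]
      calc β * (c * x n) ≤ β * (β⁻¹ * x n) := by gcongr; exact min_le_left _ _
        _ = x n := by rw [mul_inv_cancel_left₀ hβ.ne']
    calc ∑' n, orliczOf k (c * x n) ≤ ∑' n, (D * G n (x n) + 2⁻¹ ^ n) :=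
          ENNReal.tsum_le_tsum hxn
      _ = D * ∑' n, G n (x n) + 2 := by
          rw [ENNReal.tsum_add, ENNReal.tsum_mul_left, tsum_two_inv_pow]
      _ ≤ D * 1 + 2 := by gcongr
  · refine modLE_of_le hm hG (c := β) hβ (M := 1 + 2) (by norm_num) fun x hx => ?_
    have hxn : ∀ n, G n (β * x n) ≤ orliczOf k (x n) + 2⁻¹ ^ n := by
      intro n
      have h1 : x n ≤ 1 := by
        by_contra! h
        have h2 := (ENNReal.le_tsum (f := fun n => orliczOf k (x n)) n).trans hx
        simp [orliczOf_of_one_lt k h] at h2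
      obtain ⟨t, ht⟩ := exists_toNNReal_eq h1
      rw [← ht, orliczOf_toNNReal]
      exact hle n t
    calc ∑' n, G n (β * x n) ≤ ∑' n, (orliczOf k (x n) + 2⁻¹ ^ n) :=
          ENNReal.tsum_le_tsum hxn
      _ = ∑' n, orliczOf k (x n) + 2 := by rw [ENNReal.tsum_add, tsum_two_inv_pow]
      _ ≤ 1 + 2 := by gcongr

lemma nnnorm_coe_nnreal (𝕜 : Type*) [RCLike 𝕜] (c : ℝ≥0) : ‖((c : ℝ) : 𝕜)‖₊ = c := by
  ext; simp

/-! ### Sequence spaces whose unit ball is given by a modular -/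

namespace SequenceSpace

variable {𝕜 : Type*} [RCLike 𝕜] {S : SequenceSpace 𝕜}

lemma nrm_smul_nnreal (c : ℝ≥0) (a : S.carrier) : S.nrm (((c : ℝ) : 𝕜) • a) = c * S.nrm a := by
  rw [S.nrm_smul, nnnorm_coe_nnreal]

lemma nnnorm_smul_apply (c : ℝ≥0) (a : S.carrier) (n : ℕ) :
    ‖((((c : ℝ) : 𝕜) • a : S.carrier) : ℕ → 𝕜) n‖₊ = c * ‖(a : ℕ → 𝕜) n‖₊ := by
  rw [Submodule.coe_smul, Pi.smul_apply, smul_eq_mul, nnnorm_mul, nnnorm_coe_nnreal]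

lemma mem_of_smul_mem {c r : ℝ≥0} (hc : 0 < c) {a : ℕ → 𝕜}
    (h : ∃ h : ((c : ℝ) : 𝕜) • a ∈ S.carrier, S.nrm ⟨_, h⟩ ≤ r) :
    ∃ h : a ∈ S.carrier, S.nrm ⟨a, h⟩ ≤ c⁻¹ * r := by
  obtain ⟨h, hr⟩ := h
  have hc' : ((c : ℝ) : 𝕜) ≠ 0 := by exact_mod_cast hc.ne'
  have ha : a ∈ S.carrier := (S.carrier.smul_mem_iff hc').1 h
  refine ⟨ha, ?_⟩
  have h1 : S.nrm ⟨_, h⟩ = c * S.nrm ⟨a, ha⟩ := nrm_smul_nnreal c ⟨a, ha⟩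
  rw [h1] at hr
  rwa [le_inv_mul_iff₀ hc]

/-- Up to constants, the unit ball of `S` is that of the modular defined by the functions
`G n`. -/
def IsModular (S : SequenceSpace 𝕜) (G : ℕ → ℝ≥0 → ℝ≥0∞) : Prop :=
  (∃ c : ℝ≥0, 0 < c ∧ ∀ a : S.carrier, S.nrm a ≤ 1 → ∑' n, G n (c * ‖(a : ℕ → 𝕜) n‖₊) ≤ 1) ∧
  ∃ C : ℝ≥0, 0 < C ∧ ∀ a : ℕ → 𝕜, ∑' n, G n ‖a n‖₊ ≤ 1 →
    ∃ h : a ∈ S.carrier, S.nrm ⟨a, h⟩ ≤ C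

lemma IsModular.congr {G H : ℕ → ℝ≥0 → ℝ≥0∞} (hS : S.IsModular G) (h1 : ModLE G H)
    (h2 : ModLE H G) : S.IsModular H := by
  obtain ⟨⟨c, hc, hc'⟩, C, hC, hC'⟩ := hS
  obtain ⟨d, hd, hd'⟩ := h1
  obtain ⟨e, he, he'⟩ := h2
  refine ⟨⟨d * c, mul_pos hd hc, fun a ha => ?_⟩, e⁻¹ * C, mul_pos (inv_pos.2 he) hC,
    fun a ha => mem_of_smul_mem he (hC' _ ?_)⟩
  · simpa only [mul_assoc] using hd' _ (hc' a ha)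
  · simpa only [Pi.smul_apply, smul_eq_mul, nnnorm_mul, nnnorm_coe_nnreal] using he' _ ha

/-- Subsymmetry identifies `S` with its part supported on `π(ℕ)`, where the modular only involves
the functions `G (π n)`. -/
lemma IsModular.comp_strictMono {G : ℕ → ℝ≥0 → ℝ≥0∞} (hG : ∀ n, G n 0 = 0)
    (hS : S.IsModular G) (hsub : S.IsSubsymmetric) {π : ℕ → ℕ} (hπ : StrictMono π) :
    S.IsModular fun n => G (π n) := by
  obtain ⟨⟨c, hc, hc'⟩, C, hC, hC'⟩ := hS
  obtain ⟨hiso, hsurj⟩ := hsub π hπ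
  refine ⟨⟨c, hc, fun g hg => ?_⟩, C, hC, fun a ha => ?_⟩
  · obtain ⟨f, hf, hfg⟩ := hsurj g
    obtain ⟨h, hn⟩ := hiso f hf
    have h1 : (⟨_, h⟩ : S.carrier) = g := Subtype.ext (funext hfg)
    rw [h1] at hn
    simp_rw [← hfg]
    exact (ENNReal.tsum_comp_le_tsum_of_injective hπ.injective
      fun n => G n (c * ‖(f : ℕ → 𝕜) n‖₊)).trans (hc' f (hn ▸ hg))
  · have hext : ∀ n, Function.extend π a 0 (π n) = a n := hπ.injective.extend_apply a 0
    have hsupp : Function.support (Function.extend π a 0) ⊆ Set.range π := by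
      intro n hn
      by_contra h
      exact hn (by rw [Function.extend_apply' _ _ _ (by simpa using h)]; rfl)
    obtain ⟨hf, hfn⟩ := hC' (Function.extend π a 0) (by
      rw [← hπ.injective.tsum_eq]
      · simpa only [hext] using ha
      · intro n hn
        refine hsupp fun h0 => hn ?_
        simp [h0, hG])
    obtain ⟨h, hn⟩ := hiso ⟨_, hf⟩ hsupp
    simp only [hext] at h hn
    exact ⟨h, hn.le.trans hfn⟩

lemma IsModular.eqOrliczSpace {m : ℝ} (hm : 0 < m) {F : ℝ≥0 → ℝ≥0∞} (hF : PowerScaled m F)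
    (hS : S.IsModular fun _ => F) : S.EqOrliczSpace F := by
  obtain ⟨⟨c, hc, hc'⟩, C, hC, hC'⟩ := hS
  have key : ∀ ε : ℝ≥0∞, ε ≠ 0 → ∃ δ : ℝ≥0, 0 < δ ∧ ∀ a : S.carrier, S.nrm a ≤ δ →
      ∑' n, F ‖(a : ℕ → 𝕜) n‖₊ < ε := by
    intro ε hε
    obtain ⟨s, hs0, hs1, hs⟩ := exists_rpow_mul_lt hm ENNReal.one_ne_top hε
    refine ⟨s * c, mul_pos hs0 hc, fun a ha => ?_⟩
    have h1 := hc' (((((s * c)⁻¹ : ℝ≥0) : ℝ) : 𝕜) • a) (by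
      rw [nrm_smul_nnreal]
      exact (inv_mul_le_one₀ (mul_pos hs0 hc)).2 ha)
    simp only [nnnorm_smul_apply] at h1
    have h2 := tsum_mul_le_of_powerScaled (fun _ => hF) hs1
      fun n => c * ((s * c)⁻¹ * ‖(a : ℕ → 𝕜) n‖₊)
    simp only [← mul_assoc s c, mul_inv_cancel_left₀ (mul_pos hs0 hc).ne'] at h2
    refine h2.trans_lt (lt_of_le_of_lt ?_ hs)
    gcongr
  refine ⟨fun a => ⟨fun ha => ?_, ?_⟩, fun u ε hu hε => ?_, fun δ hδ => ?_⟩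
  · obtain ⟨δ, hδ, h⟩ := key ∞ (by simp)
    obtain ⟨t, ht, ht'⟩ : ∃ t : ℝ≥0, 0 < t ∧ t * S.nrm ⟨a, ha⟩ ≤ δ := by
      refine ⟨δ / (S.nrm ⟨a, ha⟩ + 1), by positivity, ?_⟩
      rw [div_mul_eq_mul_div]
      exact div_le_of_le_mul₀ zero_le zero_le (by gcongr; exact le_self_add)
    refine ⟨t, ht, ?_⟩
    have h1 := h (((t : ℝ) : 𝕜) • ⟨a, ha⟩) (by rwa [nrm_smul_nnreal])
    simpa only [modular, lintegral_count, nnnorm_smul_apply] using h1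
  · rintro ⟨t, ht, h⟩
    rw [modular, lintegral_count] at h
    obtain ⟨s, hs0, hs1, hs⟩ := exists_rpow_mul_lt hm h.ne one_ne_zero
    have h1 := (tsum_mul_le_of_powerScaled (fun _ => hF) hs1 _).trans hs.le
    refine (mem_of_smul_mem (r := C) (mul_pos hs0 ht) (hC' _ ?_)).1
    simpa only [Pi.smul_apply, smul_eq_mul, nnnorm_mul, nnnorm_coe_nnreal, mul_assoc] using h1
  · obtain ⟨δ, hδ, h⟩ := key ε (by exact_mod_cast hε.ne')
    refine ⟨u * δ, mul_pos hu hδ, fun a ha => ?_⟩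
    have h1 := h ((((u⁻¹ : ℝ≥0) : ℝ) : 𝕜) • a) (by
      rw [nrm_smul_nnreal, inv_mul_le_iff₀ hu]
      exact ha.le)
    rw [modular, lintegral_count]
    simpa only [nnnorm_smul_apply, div_eq_inv_mul] using h1
  · refine ⟨δ / (2 * C), 1, by positivity, one_pos, fun a ha => ?_⟩
    rw [modular, lintegral_count] at ha
    set u := δ / (2 * C) with hu
    have hu0 : 0 < u := by positivity
    obtain ⟨h, hn⟩ := mem_of_smul_mem (r := C) (a := (a : ℕ → 𝕜)) (inv_pos.2 hu0) (hC' _ (by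
      simpa only [Pi.smul_apply, smul_eq_mul, nnnorm_mul, nnnorm_coe_nnreal, div_eq_inv_mul,
        ENNReal.coe_one] using ha.le))
    refine hn.trans_lt ?_
    rw [inv_inv, hu]
    field_simp
    norm_num

/-- `F` is comparable with `k` only near zero, so coordinates must first be confined there. A small
modular does this because `F` is positive at some `t₀`. -/
lemma EqOrliczSpace.isModular {m : ℝ} (hm : 0 < m) {F : ℝ≥0 → ℝ≥0∞} (hF : IsOrlicz F)
    (hS : S.EqOrliczSpace F) {k : C(I, ℝ)} (hk : PowerBounded m k) {c A B : ℝ} (hc : 0 < c)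
    (hA : 0 < A) (h : ∀ t : I, (t : ℝ) ≤ c →
      ENNReal.ofReal (A * k t) ≤ F (unitInterval.toNNReal t) ∧
      F (unitInterval.toNNReal t) ≤ ENNReal.ofReal (B * k t)) :
    S.IsModular fun _ => orliczOf k := by
  obtain ⟨hmem, hsmall, hlarge⟩ := hS
  have hk' := hk.powerScaled hm
  obtain ⟨t₀, ht₀, hFt₀⟩ : ∃ t₀ : ℝ≥0, 0 < t₀ ∧ 0 < F t₀ := by
    obtain ⟨L, hL, hlim⟩ := hF.top_pos
    exact ((eventually_gt_atTop 0).and (hlim.eventually_const_lt hL)).exists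
  have hle : ∀ t : ℝ≥0, t ≤ 1 → (t : ℝ) ≤ c →
      ENNReal.ofReal A * orliczOf k t ≤ F t ∧ F t ≤ ENNReal.ofReal B * orliczOf k t := by
    intro t ht htc
    obtain ⟨u, rfl⟩ := exists_toNNReal_eq ht
    have h1 := h u htc
    rwa [ENNReal.ofReal_mul hA.le, ENNReal.ofReal_mul' (hk.1 u), ← orliczOf_toNNReal] at h1
  lift c to ℝ≥0 using hc.le
  rw [NNReal.coe_pos] at hc
  constructor
  · obtain ⟨ε, hε, hε'⟩ : ∃ ε : ℝ≥0, 0 < ε ∧ (ε : ℝ≥0∞) < min (F t₀) (ENNReal.ofReal A) := by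
      obtain ⟨ε, h0, h1⟩ := ENNReal.lt_iff_exists_nnreal_btwn.1
        (lt_min hFt₀ (ENNReal.ofReal_pos.2 hA))
      exact ⟨ε, by exact_mod_cast h0, h1⟩
    obtain ⟨δ, hδ, hδ'⟩ := hsmall 1 ε one_pos hε
    set s : ℝ≥0 := min 1 (min t₀⁻¹ (c / t₀)) with hs
    have hs0 : 0 < s := lt_min one_pos (lt_min (inv_pos.2 ht₀) (div_pos hc ht₀))
    refine ⟨s * (δ / 2), by positivity, fun a ha => ?_⟩
    have h1 := hδ' ((((δ / 2 : ℝ≥0) : ℝ) : 𝕜) • a) (by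
      rw [nrm_smul_nnreal]
      calc δ / 2 * S.nrm a ≤ δ / 2 * 1 := by gcongr
        _ < δ := by simpa using NNReal.half_lt_self hδ.ne')
    rw [modular, lintegral_count] at h1
    simp only [nnnorm_smul_apply, div_one] at h1
    have hx : ∀ n, ENNReal.ofReal A * orliczOf k (s * (δ / 2) * ‖(a : ℕ → 𝕜) n‖₊) ≤
        F (δ / 2 * ‖(a : ℕ → 𝕜) n‖₊) := by
      intro n
      set x := δ / 2 * ‖(a : ℕ → 𝕜) n‖₊ with hxdef
      have hxt : x ≤ t₀ := by
        by_contra! hlt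
        refine absurd ((hF.mono hlt.le).trans ((ENNReal.le_tsum n).trans h1.le)) ?_
        exact (hε'.trans_le (min_le_left _ _)).not_ge
      have h2 : s * x ≤ 1 := by
        calc s * x ≤ t₀⁻¹ * t₀ := by
              gcongr; exact (min_le_right _ _).trans (min_le_left _ _)
          _ = 1 := inv_mul_cancel₀ ht₀.ne'
      have h3 : s * x ≤ c := by
        calc s * x ≤ c / t₀ * t₀ := by
              gcongr; exact (min_le_right _ _).trans (min_le_right _ _)
          _ = c := div_mul_cancel₀ _ ht₀.ne'
      have h4 : s * x ≤ x := mul_le_of_le_one_left' (min_le_left _ _)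
      rw [mul_assoc, ← hxdef]
      exact (hle _ h2 h3).1.trans (hF.mono h4)
    have h2 := ENNReal.tsum_le_tsum hx
    rw [ENNReal.tsum_mul_left] at h2
    have hA0 : ENNReal.ofReal A ≠ 0 := (ENNReal.ofReal_pos.2 hA).ne'
    have h3 := h2.trans (h1.le.trans (hε'.le.trans (min_le_right _ _)))
    exact (ENNReal.mul_le_mul_iff_right hA0 ENNReal.ofReal_ne_top).1 (by simpa using h3)
  · obtain ⟨u, ε, hu, hε, hlt⟩ := hlarge 1 one_pos
    obtain ⟨s, hs0, hs1, hs⟩ := exists_rpow_mul_lt hm (M := ENNReal.ofReal B)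
      ENNReal.ofReal_ne_top (ε := ε) (by exact_mod_cast hε.ne')
    -- The factor `min c 1` moves the coordinates into the range of the comparison, and `s` brings
    -- the modular of `F` below `ε`.
    set r := s * min c 1 with hr
    have hr0 : 0 < r := mul_pos hs0 (lt_min hc one_pos)
    have hr1 : r ≤ 1 := mul_le_one₀ hs1 zero_le (min_le_right _ _)
    have hrc : r ≤ c := (mul_le_of_le_one_left' hs1).trans (min_le_left _ _)
    have hrs : r ≤ s := mul_le_of_le_one_right' (min_le_right _ _)
    refine ⟨(u * r)⁻¹, by positivity, fun a ha => ?_⟩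
    have h1 : ∀ n, F (r * ‖a n‖₊) ≤ ENNReal.ofReal B * orliczOf k (r * ‖a n‖₊) := by
      intro n
      have ha1 : ‖a n‖₊ ≤ 1 := by
        by_contra! hlt
        have h2 := (ENNReal.le_tsum (f := fun n => orliczOf k ‖a n‖₊) n).trans ha
        simp [orliczOf_of_one_lt k hlt] at h2
      have h3 : r * ‖a n‖₊ ≤ r := mul_le_of_le_one_right' ha1
      exact (hle _ (h3.trans hr1) (h3.trans hrc)).2
    have h2 : ∑' n, F (r * ‖a n‖₊) < ε := by
      refine lt_of_le_of_lt ?_ hs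
      calc ∑' n, F (r * ‖a n‖₊) ≤ ENNReal.ofReal B * ∑' n, orliczOf k (r * ‖a n‖₊) := by
            rw [← ENNReal.tsum_mul_left]; exact ENNReal.tsum_le_tsum h1
        _ ≤ ENNReal.ofReal B * ((r : ℝ≥0∞) ^ m * 1) := by
            gcongr
            refine (tsum_mul_le_of_powerScaled (fun _ => hk') hr1 _).trans ?_
            gcongr
        _ ≤ (s : ℝ≥0∞) ^ m * ENNReal.ofReal B := by
            rw [mul_one, mul_comm]
            gcongr
    have h3 : ∀ n, ‖((((u * r : ℝ≥0) : ℝ) : 𝕜) • a) n‖₊ / u = r * ‖a n‖₊ := by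
      intro n
      rw [Pi.smul_apply, smul_eq_mul, nnnorm_mul, nnnorm_coe_nnreal, mul_assoc,
        mul_div_cancel_left₀ _ hu.ne']
    have h4 : ((((u * r : ℝ≥0) : ℝ) : 𝕜) • a) ∈ S.carrier := by
      refine (hmem _).2 ⟨u⁻¹, inv_pos.2 hu, ?_⟩
      rw [modular, lintegral_count]
      simp_rw [← div_eq_inv_mul, h3]
      exact h2.trans ENNReal.coe_lt_top
    have h5 := hlt ⟨_, h4⟩ (by
      rw [modular, lintegral_count]
      simp_rw [h3]
      exact h2)
    obtain ⟨h6, h7⟩ := mem_of_smul_mem (mul_pos hu hr0) ⟨h4, h5.le⟩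
    exact ⟨h6, by simpa using h7⟩

end SequenceSpace

/-! ### The modular of `L_P` under dilations and on disjoint sums -/

section Modular

variable {Ω : Type*} [MeasurableSpace Ω] {μ : Measure Ω} {P : Ω → ℝ≥0∞}
  {𝕜 : Type*} [RCLike 𝕜]

lemma exists_pos_le_expMinus (hP : 0 < expMinus P μ) :
    ∃ m : ℝ, 0 < m ∧ ENNReal.ofReal m ≤ expMinus P μ := by
  obtain ⟨m, h0, h1⟩ := ENNReal.lt_iff_exists_nnreal_btwn.1 hP
  exact ⟨m, by exact_mod_cast h0, by simpa using h1.le⟩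

lemma ae_mem_essRange (hP : Measurable P) : ∀ᵐ ω ∂μ, P ω ∈ essRange P μ :=
  ae_of_ae_map hP.aemeasurable Measure.support_mem_ae

lemma luxemburg_le {M : Ω → ℝ≥0 → ℝ≥0∞} {f : Ω → 𝕜} {t : ℝ≥0} (ht : 0 < t)
    (h : modular M μ (fun ω => ‖f ω‖₊ / t) < 1) : luxemburg M μ f ≤ t :=
  iInf_le_of_le t (iInf_le_of_le ht (iInf_le _ h))

lemma modular_lt_one_of_luxemburg_lt {f : Ω → 𝕜} {t : ℝ≥0}
    (h : luxemburg (expMO P) μ f < t) : modular (expMO P) μ (fun ω => ‖f ω‖₊ / t) < 1 := by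
  simp only [luxemburg, iInf_lt_iff] at h
  obtain ⟨s, hs0, hs, hst⟩ := h
  refine lt_of_le_of_lt (lintegral_mono fun ω => powerFn_mono _ ?_) hs
  have : s ≤ t := by exact_mod_cast hst.le
  exact div_le_div_of_nonneg_left zero_le hs0 this

/-- The modular of `t f` in `L_P`, as a function of `t`. -/
noncomputable def dilatedModular (P : Ω → ℝ≥0∞) (μ : Measure Ω) (f : Ω → ℝ≥0) (t : ℝ≥0) : ℝ≥0∞ :=
  modular (expMO P) μ fun ω => t * f ω

lemma powerScaled_dilatedModular {m : ℝ} (hm : 0 < m) (hP : ∀ᵐ ω ∂μ, ENNReal.ofReal m ≤ P ω)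
    (f : Ω → ℝ≥0) : PowerScaled m (dilatedModular P μ f) := by
  intro s t hs
  rw [dilatedModular, dilatedModular, modular, modular, ← lintegral_const_mul' _ _
    (ENNReal.rpow_ne_top_of_nonneg hm.le ENNReal.coe_ne_top)]
  refine lintegral_mono_ae ?_
  filter_upwards [hP] with ω hω
  rw [mul_assoc]
  exact powerFn_mul_le hm hω hs _

/-- At most one of the `x i` is nonzero, so both sums have at most one nonzero term. -/
lemma powerFn_nnnorm_sum {p : ℝ≥0∞} (hp : 0 < p) (r : ℝ≥0) (a x : ℕ → 𝕜)
    (hx : ∀ i j, i ≠ j → x i = 0 ∨ x j = 0) (n : ℕ) :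
    powerFn p (r * ‖∑ i ∈ Finset.range n, a i * x i‖₊) =
      ∑ i ∈ Finset.range n, powerFn p (r * ‖a i‖₊ * ‖x i‖₊) := by
  by_cases h : ∃ i ∈ Finset.range n, x i ≠ 0
  · obtain ⟨i, hi, hxi⟩ := h
    have h0 : ∀ j ∈ Finset.range n, j ≠ i → x j = 0 := fun j _ hj => (hx j i hj).resolve_right hxi
    rw [Finset.sum_eq_single_of_mem i hi fun j hj hji => by rw [h0 j hj hji, mul_zero],
      Finset.sum_eq_single_of_mem i hi fun j hj hji => by
        rw [h0 j hj hji, nnnorm_zero, mul_zero, powerFn_zero hp], nnnorm_mul, mul_assoc]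
  · push Not at h
    rw [Finset.sum_eq_zero fun i hi => by rw [h i hi, mul_zero],
      Finset.sum_eq_zero fun i hi => by rw [h i hi, nnnorm_zero, mul_zero, powerFn_zero hp],
      nnnorm_zero, mul_zero, powerFn_zero hp]

end Modular

/-! ### The modular defined by a disjoint embedding -/

namespace SequenceSpace

variable {𝕜 : Type*} [RCLike 𝕜] {S : SequenceSpace 𝕜}
  {Ω : Type*} [MeasurableSpace Ω] {μ : Measure Ω} {P : Ω → ℝ≥0∞}

/-- The increasing map `k ↦ k + n` carries `e_n` to `e_0`. -/
lemma nrm_unitVec (hsub : S.IsSubsymmetric) (n : ℕ) : S.nrm (S.unitVec n) = S.nrm (S.unitVec 0) := by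
  have hπ : StrictMono fun k : ℕ => k + n := fun i j h => Nat.add_lt_add_right h n
  obtain ⟨h, hn⟩ := (hsub _ hπ).1 (S.unitVec n) (by
    intro k hk
    have : k = n := by
      by_contra hkn
      exact hk (by simp [unitVec, hkn])
    exact ⟨0, by simp [this]⟩)
  rw [← hn]
  congr 1
  refine Subtype.ext (funext fun k => ?_)
  simp [unitVec, Pi.single_apply]

lemma nrm_unitVec_pos (n : ℕ) : 0 < S.nrm (S.unitVec n) := by
  refine pos_iff_ne_zero.2 fun h => ?_
  have h1 := congrFun (congrArg Subtype.val (S.nrm_eq_zero _ h)) n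
  simp [unitVec] at h1

/-- The restriction of a sequence to its first `n` coordinates. -/
noncomputable def truncate (S : SequenceSpace 𝕜) (a : ℕ → 𝕜) (n : ℕ) : S.carrier :=
  ∑ i ∈ Finset.range n, a i • S.unitVec i

lemma truncate_apply (a : ℕ → 𝕜) (n j : ℕ) :
    (S.truncate a n : ℕ → 𝕜) j = if j < n then a j else 0 := by
  rw [truncate, Submodule.coe_sum, Finset.sum_apply]
  simp [unitVec, Pi.single_apply]

lemma map_truncate (T : S.carrier →ₗ[𝕜] (Ω →ₘ[μ] 𝕜)) (a : ℕ → 𝕜) (n : ℕ) :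
    ∀ᵐ ω ∂μ, T (S.truncate a n) ω = ∑ i ∈ Finset.range n, a i * T (S.unitVec i) ω := by
  induction n with
  | zero =>
    filter_upwards [AEEqFun.coeFn_zero (α := Ω) (β := 𝕜) (μ := μ)] with ω hω
    simpa [truncate] using hω
  | succ n ih =>
    have h1 : T (S.truncate a (n + 1)) = T (S.truncate a n) + a n • T (S.unitVec n) := by
      rw [truncate, Finset.sum_range_succ, map_add, map_smul, truncate]
    filter_upwards [ih, AEEqFun.coeFn_add (T (S.truncate a n)) (a n • T (S.unitVec n)),
      AEEqFun.coeFn_smul (a n) (T (S.unitVec n))] with ω h2 h3 h4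
    rw [h1, h3, Pi.add_apply, h2, h4, Finset.sum_range_succ, Pi.smul_apply, smul_eq_mul]

lemma modular_map_truncate (hP : IsVarExponent P) (T : S.carrier →ₗ[𝕜] (Ω →ₘ[μ] 𝕜))
    (hT : ∀ m n, m ≠ n → ∀ᵐ ω ∂μ, T (S.unitVec m) ω = 0 ∨ T (S.unitVec n) ω = 0)
    (a : ℕ → 𝕜) (n : ℕ) (r : ℝ≥0) :
    modular (expMO P) μ (fun ω => r * ‖T (S.truncate a n) ω‖₊) =
      ∑ i ∈ Finset.range n,
        dilatedModular P μ (fun ω => ‖T (S.unitVec i) ω‖₊) (r * ‖a i‖₊) := by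
  simp only [dilatedModular, modular]
  rw [← lintegral_finsetSum]
  · refine lintegral_congr_ae ?_
    have hT' : ∀ᵐ ω ∂μ, ∀ m n, m ≠ n → T (S.unitVec m) ω = 0 ∨ T (S.unitVec n) ω = 0 := by
      simp only [ae_all_iff]
      exact hT
    filter_upwards [map_truncate T a n, hT'] with ω h1 h2
    rw [h1]
    exact powerFn_nnnorm_sum (hP.2 ω) r a _ h2 n
  · intro i _
    exact measurable_powerFn hP.1
      ((AEEqFun.stronglyMeasurable _).measurable.nnnorm.const_mul _)

/-- `T` is merely linear, so its modular is computed on finitely supported truncations only. The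
lattice property controls the truncations by `a`, and the Fatou property recovers `a` from them. -/
lemma isModular_of_map (hP : IsVarExponent P) {m : ℝ} (hm : 0 < m)
    (hmP : ∀ᵐ ω ∂μ, ENNReal.ofReal m ≤ P ω) (T : S.carrier →ₗ[𝕜] (Ω →ₘ[μ] 𝕜)) {C : ℝ≥0}
    (hC : ∀ a, luxemburg (expMO P) μ (T a) ≤ C * S.nrm a ∧
      (S.nrm a : ℝ≥0∞) ≤ C * luxemburg (expMO P) μ (T a))
    (hT : ∀ m n, m ≠ n → ∀ᵐ ω ∂μ, T (S.unitVec m) ω = 0 ∨ T (S.unitVec n) ω = 0) :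
    S.IsModular fun n => dilatedModular P μ fun ω => ‖T (S.unitVec n) ω‖₊ := by
  constructor
  · refine ⟨(C + 1)⁻¹, by positivity, fun a ha => ENNReal.tsum_le_of_sum_range_le fun n => ?_⟩
    rw [← modular_map_truncate hP T hT]
    have h1 : S.nrm (S.truncate a n) ≤ 1 := by
      obtain ⟨h, hn⟩ := S.lattice a (S.truncate a n) fun j => by
        rw [truncate_apply]
        split_ifs <;> simp
      exact hn.trans ha
    -- The gauge is an infimum, so the modular is only controlled strictly above it; hence `C + 1`.
    have h2 : luxemburg (expMO P) μ (T (S.truncate a n)) < ((C + 1 : ℝ≥0) : ℝ≥0∞) := by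
      refine (hC _).1.trans_lt ?_
      rw [← ENNReal.coe_mul, ENNReal.coe_lt_coe]
      calc C * S.nrm (S.truncate a n) ≤ C * 1 := by gcongr
        _ < C + 1 := by simp
    simpa only [div_eq_inv_mul] using (modular_lt_one_of_luxemburg_lt h2).le
  · obtain ⟨s, hs0, hs1, hs⟩ := exists_rpow_mul_lt hm ENNReal.one_ne_top one_ne_zero
    obtain ⟨D, hD⟩ := S.fatou
    refine ⟨D * (C * s⁻¹) + 1, by positivity, fun a ha => ?_⟩
    have h1 : ∀ n, (S.nrm (S.truncate a n) : ℝ≥0∞) ≤ (C * s⁻¹ : ℝ≥0) := by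
      intro n
      refine (hC _).2.trans ?_
      rw [ENNReal.coe_mul]
      gcongr
      refine luxemburg_le (inv_pos.2 hs0) ?_
      simp only [div_inv_eq_mul, mul_comm _ s]
      rw [modular_map_truncate hP T hT]
      refine lt_of_le_of_lt ((ENNReal.sum_le_tsum _).trans ?_) hs
      refine (tsum_mul_le_of_powerScaled
        (fun n => powerScaled_dilatedModular hm hmP _) hs1 _).trans ?_
      gcongr
    have h2 : limsup (fun k => (S.nrm (S.truncate a k) : ℝ≥0∞)) atTop ≤ (C * s⁻¹ : ℝ≥0) :=
      limsup_le_of_le (h := Eventually.of_forall h1)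
    obtain ⟨h, hn⟩ := hD (S.truncate a) a (fun n => by
      refine tendsto_const_nhds.congr' ?_
      filter_upwards [eventually_gt_atTop n] with k hk
      rw [truncate_apply, if_pos hk]) (h2.trans_lt ENNReal.coe_lt_top)
    refine ⟨h, ?_⟩
    have h3 := hn.trans (mul_le_mul_right h2 _)
    rw [← ENNReal.coe_mul, ENNReal.coe_le_coe] at h3
    exact h3.trans le_self_add

end SequenceSpace

/-! ### Dilated modulars as means of power functions -/

section Density

variable {Ω : Type*} [MeasurableSpace Ω] {μ : Measure Ω} {P : Ω → ℝ≥0∞}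

/-- The density `p e^{-p} Φ_p(b f)`, with `p = P(ω)`. -/
noncomputable def expDensity (P : Ω → ℝ≥0∞) (f : Ω → ℝ≥0) (b : ℝ≥0) (ω : Ω) : ℝ≥0∞ :=
  ENNReal.ofReal ((P ω).toReal * Real.exp (-(P ω).toReal)) * powerFn (P ω) (b * f ω)

lemma mul_exp_neg_le_one (x : ℝ) : x * Real.exp (-x) ≤ 1 := by
  have h := Real.add_one_le_exp x
  rw [Real.exp_neg, ← div_eq_mul_inv, div_le_one (Real.exp_pos x)]
  linarith

lemma expDensity_le {Ω : Type*} {P : Ω → ℝ≥0∞} (f : Ω → ℝ≥0) (b : ℝ≥0) (ω : Ω) :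
    expDensity P f b ω ≤ powerFn (P ω) (b * f ω) :=
  mul_le_of_le_one_left' (ENNReal.ofReal_le_one.2 (mul_exp_neg_le_one _))

lemma measurable_expDensity (hP : Measurable P) {f : Ω → ℝ≥0} (hf : Measurable f) (b : ℝ≥0) :
    Measurable (expDensity P f b) := by
  refine Measurable.mul ?_ (measurable_powerFn hP (hf.const_mul b))
  exact (hP.ennreal_toReal.mul (Real.measurable_exp.comp hP.ennreal_toReal.neg)).ennreal_ofReal

/-- `(t/e)^p = (t^p/p) · p e^{-p}`: the dilation by `1/e` produces a weight `p e^{-p}` that is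
bounded in `p`. For `p = ∞`, finiteness means `b x ≤ 1`, and both sides vanish. -/
lemma powerFn_eq_psi_mul {p : ℝ≥0∞} (hp : 0 < p) {x b : ℝ≥0} (hx : powerFn p (b * x) < ∞) (t : I) :
    powerFn p (b * (Real.exp (-1)).toNNReal * unitInterval.toNNReal t * x) =
      ENNReal.ofReal (psi p t) *
        (ENNReal.ofReal (p.toReal * Real.exp (-p.toReal)) * powerFn p (b * x)) := by
  by_cases h : p = ∞
  · subst h
    have h1 : b * x ≤ 1 := by
      by_contra h1
      simp [powerFn_top, h1] at hx
    have h2 : (Real.exp (-1)).toNNReal ≤ 1 := by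
      rw [Real.toNNReal_le_one]
      exact Real.exp_le_one_iff.2 (by norm_num)
    have h3 : unitInterval.toNNReal t ≤ 1 := t.2.2
    have h4 : b * (Real.exp (-1)).toNNReal * unitInterval.toNNReal t * x ≤ 1 := by
      calc b * (Real.exp (-1)).toNNReal * unitInterval.toNNReal t * x
          ≤ b * 1 * 1 * x := by gcongr
        _ ≤ 1 := by simpa using h1
    rw [powerFn_top, if_pos h4, psi_top, ENNReal.ofReal_zero, zero_mul]
  · have hp' := ENNReal.toReal_pos hp.ne' h
    rw [powerFn_of_ne_top h, powerFn_of_ne_top h, psi_of_ne_top h]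
    set q := p.toReal with hq
    have e1 : b * (Real.exp (-1)).toNNReal * unitInterval.toNNReal t * x =
        (unitInterval.toNNReal t * (Real.exp (-1)).toNNReal) * (b * x) := by ring
    rw [e1, ENNReal.coe_mul, ENNReal.mul_rpow_of_nonneg _ _ hp'.le, ← mul_assoc]
    congr 1
    rw [← ENNReal.ofReal_mul (div_nonneg (Real.rpow_nonneg t.2.1 _) hp'.le),
      ← ENNReal.coe_rpow_of_nonneg _ hp'.le, ENNReal.ofReal, ENNReal.coe_inj]
    ext
    rw [NNReal.coe_rpow, NNReal.coe_mul, unitInterval.coe_toNNReal,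
      Real.coe_toNNReal _ (Real.exp_pos _).le, Real.mul_rpow t.2.1 (Real.exp_pos _).le,
      Real.coe_toNNReal _ (mul_nonneg (div_nonneg (Real.rpow_nonneg t.2.1 _) hp'.le)
        (mul_nonneg hp'.le (Real.exp_pos _).le)), ← Real.exp_mul]
    field_simp

lemma dilatedModular_eq_lintegral (hP : IsVarExponent P) {f : Ω → ℝ≥0} (hf : Measurable f)
    {b : ℝ≥0} (hb : dilatedModular P μ f b ≤ 1) (t : I) :
    dilatedModular P μ f (b * (Real.exp (-1)).toNNReal * unitInterval.toNNReal t) =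
      ∫⁻ ω, ENNReal.ofReal (psi (P ω) t) * expDensity P f b ω ∂μ := by
  refine lintegral_congr_ae ?_
  have hlt : ∀ᵐ ω ∂μ, powerFn (P ω) (b * f ω) < ∞ :=
    ae_lt_top (measurable_powerFn hP.1 (hf.const_mul b)) (hb.trans_lt ENNReal.one_lt_top).ne
  filter_upwards [hlt] with ω hω
  exact powerFn_eq_psi_mul (hP.2 ω) hω t

/-- `k` is the Bochner average of `ψ_P` over the finite measure `q μ`. An average of values in a
closed convex set stays in it, and evaluation at `t` commutes with the integral. -/
lemma exists_mem_convexPowers_lintegral (hP : IsVarExponent P) {m : ℝ} (hm : 0 < m)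
    (hmP : ∀ᵐ ω ∂μ, ENNReal.ofReal m ≤ P ω) {q : Ω → ℝ≥0∞} (hq : Measurable q)
    (h0 : ∫⁻ ω, q ω ∂μ ≠ 0) (h1 : ∫⁻ ω, q ω ∂μ ≠ ∞) :
    ∃ k ∈ convexPowers (essRange P μ), ∀ t : I,
      ∫⁻ ω, ENNReal.ofReal (psi (P ω) t) * q ω ∂μ =
        ENNReal.ofReal ((∫⁻ ω, q ω ∂μ).toReal * k t) := by
  set ν := μ.withDensity q with hν
  have hνu : ν Set.univ = ∫⁻ ω, q ω ∂μ := by rw [hν, withDensity_apply _ .univ, setLIntegral_univ]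
  have : IsFiniteMeasure ν := ⟨by rw [hνu]; exact h1.lt_top⟩
  have : NeZero ν := ⟨fun h => h0 (by rw [← hνu, h]; simp)⟩
  have hac : ν ≪ μ := withDensity_absolutelyContinuous μ q
  have hu : ∀ ω, psi (P ω) = psiInv (P ω)⁻¹.toReal := fun ω => psi_eq_psiInv (hP.2 ω)
  have hmeas : AEStronglyMeasurable (fun ω => psi (P ω)) ν := by
    simp_rw [hu]
    exact (lipschitzWith_psiInv.continuous.stronglyMeasurable.comp_measurable
      hP.1.inv.ennreal_toReal).aestronglyMeasurable
  have hint : Integrable (fun ω => psi (P ω)) ν := by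
    refine Integrable.of_bound hmeas m⁻¹ (hac.ae_le ?_)
    filter_upwards [hmP] with ω hω
    exact (norm_psi_le (hP.2 ω)).trans (inv_toReal_le hm hω)
  refine ⟨⨍ ω, psi (P ω) ∂ν, ?_, fun t => ?_⟩
  · refine Convex.average_mem (convex_convexHull ℝ _).closure isClosed_closure (hac.ae_le ?_) hint
    filter_upwards [ae_mem_essRange hP.1] with ω hω
    exact subset_closure (subset_convexHull ℝ _ ⟨_, hω, rfl⟩)
  · have h2 : (∫ ω, psi (P ω) ∂ν) t = ∫ ω, psi (P ω) t ∂ν :=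
      ((ContinuousMap.evalCLM ℝ t).integral_comp_comm hint).symm
    have h3 : Integrable (fun ω => psi (P ω) t) ν :=
      (ContinuousMap.evalCLM (M := ℝ) ℝ t).integrable_comp hint
    rw [average_eq, ContinuousMap.smul_apply, smul_eq_mul, h2, Measure.real, hνu,
      mul_inv_cancel_left₀ (ENNReal.toReal_pos h0 h1).ne',
      ofReal_integral_eq_lintegral_ofReal h3 (Eventually.of_forall fun ω => psi_nonneg _ t), hν,
      lintegral_withDensity_eq_lintegral_mul _ hq (measurable_psi_comp hP.1 t).ennreal_ofReal]
    simp only [Pi.mul_apply, mul_comm]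

/-- A dilation of a function whose modular is at most one has, near zero, a multiple of an element
of the closed convex hull of the power functions as its modular. -/
lemma exists_dilatedModular_eq (hP : IsVarExponent P) {m : ℝ} (hm : 0 < m)
    (hmP : ∀ᵐ ω ∂μ, ENNReal.ofReal m ≤ P ω) {b B : ℝ≥0} (hb : 0 < b) (hbB : b ≤ B) :
    ∃ τ : ℝ, 0 < τ ∧ ∀ f : Ω → ℝ≥0, Measurable f → dilatedModular P μ f b ≤ 1 →
      1 < dilatedModular P μ f B → ∃ s : ℝ, τ ≤ s ∧ s ≤ 1 ∧ ∃ k ∈ convexPowers (essRange P μ),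
        ∀ t : I, dilatedModular P μ f (b * (Real.exp (-1)).toNNReal * unitInterval.toNNReal t) =
          ENNReal.ofReal (s * k t) := by
  have hmass : ∀ f : Ω → ℝ≥0, dilatedModular P μ f b ≤ 1 → ∫⁻ ω, expDensity P f b ω ∂μ ≤ 1 :=
    fun f hf => (lintegral_mono fun ω => expDensity_le f b ω).trans hf
  -- The mass `κ` of the density has no uniform lower bound if `P` is unbounded. But then `ψ_∞ = 0`
  -- is available, and `κ k + (1 - κ) ψ_∞` absorbs the missing mass, so that `s = 1`.
  by_cases hR : ∞ ∈ essRange P μ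
  · have hK : psi ∞ ∈ convexPowers (essRange P μ) :=
      subset_closure (subset_convexHull ℝ _ ⟨_, hR, rfl⟩)
    have hψ : psi ∞ = 0 := by ext t; simp [psi_top]
    refine ⟨1, one_pos, fun f hf h1 _ => ⟨1, le_rfl, le_rfl, ?_⟩⟩
    set κ := ∫⁻ ω, expDensity P f b ω ∂μ with hκ
    have hκ1 : κ ≤ 1 := hmass f h1
    by_cases hκ0 : κ = 0
    · refine ⟨psi ∞, hK, fun t => ?_⟩
      rw [dilatedModular_eq_lintegral hP hf h1, psi_top, mul_zero, ENNReal.ofReal_zero]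
      have h2 := (lintegral_eq_zero_iff (measurable_expDensity hP.1 hf b)).1 hκ0
      refine (lintegral_congr_ae ?_).trans lintegral_zero
      filter_upwards [h2] with ω hω
      rw [hω, Pi.zero_apply, mul_zero]
    · have hκt : κ ≠ ∞ := (hκ1.trans_lt ENNReal.one_lt_top).ne
      obtain ⟨k, hk, hk'⟩ := exists_mem_convexPowers_lintegral hP hm hmP
        (measurable_expDensity hP.1 hf b) hκ0 hκt
      have hκr : κ.toReal ≤ 1 := ENNReal.toReal_le_of_le_ofReal zero_le_one (by simpa using hκ1)
      refine ⟨κ.toReal • k + (1 - κ.toReal) • psi ∞, ?_, fun t => ?_⟩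
      · exact (convex_convexHull ℝ _).closure hk hK ENNReal.toReal_nonneg (by linarith) (by ring)
      · rw [dilatedModular_eq_lintegral hP hf h1, hk']
        simp [hψ, hκ]
  · obtain ⟨Q, hQ⟩ : ∃ Q : ℝ≥0, ∀ p ∈ essRange P μ, p ≤ Q := by
      -- The essential range is closed, so if it omits `∞` it is bounded by some finite `Q`.
      have hopen : (essRange P μ)ᶜ ∈ 𝓝 ∞ :=
        (Measure.isClosed_support (μ := μ.map P)).isOpen_compl.mem_nhds hR
      obtain ⟨Q, hQ⟩ := ENNReal.nhds_top_basis.mem_iff.1 hopen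
      have hQt : Q ≠ ∞ := hQ.1.ne
      lift Q to ℝ≥0 using hQt
      refine ⟨Q, fun p hp => ?_⟩
      by_contra! h
      exact hQ.2 h hp
    have hB : 0 < B := hb.trans_le hbB
    -- For `m ≤ p ≤ Q` one has `p e^{-p} (b/B)^p ≥ τ`, so the density at `b` is at least `τ` times
    -- the integrand at `B`, whose integral exceeds `1`.
    set τ : ℝ := m * Real.exp (-Q) * ((b / B : ℝ≥0) : ℝ) ^ (Q : ℝ) with hτ
    have hτ0 : 0 < τ := by positivity
    refine ⟨τ, hτ0, fun f hf h1 h2 => ?_⟩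
    set κ := ∫⁻ ω, expDensity P f b ω ∂μ with hκ
    have hκ1 : κ ≤ 1 := hmass f h1
    have hκt : κ ≠ ∞ := (hκ1.trans_lt ENNReal.one_lt_top).ne
    have hκτ : ENNReal.ofReal τ ≤ κ := by
      calc ENNReal.ofReal τ ≤ ENNReal.ofReal τ * dilatedModular P μ f B :=
            le_mul_of_one_le_right' h2.le
        _ = ∫⁻ ω, ENNReal.ofReal τ * powerFn (P ω) (B * f ω) ∂μ :=
            (lintegral_const_mul' _ _ ENNReal.ofReal_ne_top).symm
        _ ≤ κ := by
          refine lintegral_mono_ae ?_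
          filter_upwards [hmP, ae_mem_essRange hP.1] with ω hω1 hω2
          have hQω := hQ _ hω2
          have hne : P ω ≠ ∞ := (hQω.trans_lt ENNReal.coe_lt_top).ne
          have hp0 : 0 < (P ω).toReal := ENNReal.toReal_pos (hP.2 ω).ne' hne
          have hmp : m ≤ (P ω).toReal := (ENNReal.ofReal_le_iff_le_toReal hne).1 hω1
          have hpQ : (P ω).toReal ≤ Q := ENNReal.toReal_le_coe_of_le_coe hQω
          have e1 : b * f ω = b / B * (B * f ω) := by
            rw [← mul_assoc, div_mul_cancel₀ _ hB.ne']
          have e2 : ((b / B : ℝ≥0) : ℝ≥0∞) ^ (P ω).toReal =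
              ENNReal.ofReal (((b / B : ℝ≥0) : ℝ) ^ (P ω).toReal) := by
            rw [← ENNReal.ofReal_rpow_of_pos (by positivity), ENNReal.ofReal_coe_nnreal]
          rw [expDensity, powerFn_of_ne_top hne, powerFn_of_ne_top hne, e1, ENNReal.coe_mul (b / B),
            ENNReal.mul_rpow_of_nonneg _ _ hp0.le, ← mul_assoc, e2,
            ← ENNReal.ofReal_mul (by positivity)]
          refine mul_le_mul_left (ENNReal.ofReal_le_ofReal ?_) _
          refine mul_le_mul (mul_le_mul hmp (Real.exp_le_exp.2 (by linarith)) (Real.exp_pos _).le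
            hp0.le) ?_ (by positivity) (by positivity)
          refine Real.rpow_le_rpow_of_exponent_ge (by positivity) ?_ hpQ
          exact_mod_cast (div_le_one₀ hB).2 hbB
    have hκ0 : κ ≠ 0 := ((ENNReal.ofReal_pos.2 hτ0).trans_le hκτ).ne'
    obtain ⟨k, hk, hk'⟩ := exists_mem_convexPowers_lintegral hP hm hmP
      (measurable_expDensity hP.1 hf b) hκ0 hκt
    refine ⟨κ.toReal, (ENNReal.ofReal_le_iff_le_toReal hκt).1 hκτ,
      ENNReal.toReal_le_of_le_ofReal zero_le_one (by simpa using hκ1), k, hk, fun t => ?_⟩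
    rw [dilatedModular_eq_lintegral hP hf h1, hk']

end Density

/-! ### From a disjoint embedding to an Orlicz sequence space -/

namespace SequenceSpace

variable {𝕜 : Type*} [RCLike 𝕜] {S : SequenceSpace 𝕜}
  {Ω : Type*} [MeasurableSpace Ω] {μ : Measure Ω} {P : Ω → ℝ≥0∞}

lemma tsum_comp_single {G : ℕ → ℝ≥0 → ℝ≥0∞} (hG : ∀ n, G n 0 = 0) (c : ℝ≥0) (n : ℕ) :
    ∑' j, G j (c * ‖(Pi.single n 1 : ℕ → 𝕜) j‖₊) = G n c := by
  rw [tsum_eq_single n fun j hj => by simp [hj, hG]]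
  simp

/-- All `e_n` have the same norm `ρ`, so the two constants of `IsModular`, tested on multiples of
`e_n`, give bounds independent of `n`. -/
lemma IsModular.exists_bounds {G : ℕ → ℝ≥0 → ℝ≥0∞} (hG : ∀ n, G n 0 = 0)
    (hS : S.IsModular G) (hsub : S.IsSubsymmetric) :
    (∃ b : ℝ≥0, 0 < b ∧ ∀ n, G n b ≤ 1) ∧ ∃ B : ℝ≥0, ∀ n, 1 < G n B := by
  obtain ⟨⟨c, hc, hc'⟩, C, hC, hC'⟩ := hS
  set ρ := S.nrm (S.unitVec 0) with hρ
  have hρ0 : 0 < ρ := nrm_unitVec_pos 0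
  constructor
  · refine ⟨c * ρ⁻¹, mul_pos hc (inv_pos.2 hρ0), fun n => ?_⟩
    have h1 := hc' ((((ρ⁻¹ : ℝ≥0) : ℝ) : 𝕜) • S.unitVec n) (by
      rw [nrm_smul_nnreal, nrm_unitVec hsub, inv_mul_cancel₀ hρ0.ne'])
    simp only [nnnorm_smul_apply, ← mul_assoc] at h1
    rwa [unitVec, tsum_comp_single hG] at h1
  · refine ⟨(C + 1) * ρ⁻¹, fun n => ?_⟩
    by_contra! h
    obtain ⟨h1, h2⟩ := hC' (((((C + 1) * ρ⁻¹ : ℝ≥0) : ℝ) : 𝕜) • Pi.single n 1) (by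
      simp only [Pi.smul_apply, smul_eq_mul, nnnorm_mul, nnnorm_coe_nnreal]
      rwa [tsum_comp_single hG])
    have h3 : S.nrm ⟨_, h1⟩ = (C + 1) * ρ⁻¹ * ρ := by
      have h4 := nrm_smul_nnreal ((C + 1) * ρ⁻¹) (S.unitVec n)
      rwa [nrm_unitVec hsub n] at h4
    rw [h3, inv_mul_cancel_right₀ hρ0.ne'] at h2
    exact absurd h2 (by simp)

theorem DisjointlyEmbeds.exists_eqOrliczSpace (hP : IsVarExponent P) (hPpos : 0 < expMinus P μ)
    (hsub : S.IsSubsymmetric) (h : S.DisjointlyEmbeds μ P) :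
    ∃ F : ℝ≥0 → ℝ≥0∞, OrliczGen (essRange P μ) F ∧ S.EqOrliczSpace F := by
  obtain ⟨m, hm, hmP⟩ := exists_pos_le_expMinus hPpos
  have hmR : ∀ p ∈ essRange P μ, ENNReal.ofReal m ≤ p := fun p hp => hmP.trans (sInf_le hp)
  have hmae : ∀ᵐ ω ∂μ, ENNReal.ofReal m ≤ P ω := by
    filter_upwards [ae_mem_essRange hP.1] with ω hω using hmR _ hω
  obtain ⟨T, -, ⟨C, hC⟩, hT⟩ := h
  have hmod := isModular_of_map hP hm hmae T hC hT
  set G : ℕ → ℝ≥0 → ℝ≥0∞ := fun n => dilatedModular P μ fun ω => ‖T (S.unitVec n) ω‖₊ with hGdef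
  have hG : ∀ n, PowerScaled m (G n) := fun n => powerScaled_dilatedModular hm hmae _
  obtain ⟨⟨b, hb, hGb⟩, B, hGB⟩ := hmod.exists_bounds (fun n => (hG n).zero hm) hsub
  have hbB : b ≤ B := by
    by_contra! hlt
    exact absurd (((hG 0).le hm hlt.le).trans (hGb 0)) (hGB 0).not_ge
  obtain ⟨τ, hτ, H⟩ := exists_dilatedModular_eq hP hm hmae hb hbB
  have H' := fun n => H (fun ω => ‖T (S.unitVec n) ω‖₊)
    (AEEqFun.stronglyMeasurable _).measurable.nnnorm (hGb n) (hGB n)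
  choose s hτs hs1 k hkK hGk using H'
  have hGk' : ∀ n t, G n (b * (Real.exp (-1)).toNNReal * unitInterval.toNNReal t) =
      ENNReal.ofReal (s n * k n t) := hGk
  obtain ⟨k₀, hk₀, φ, hφ, hlim⟩ := (isCompact_convexPowers hm hmR).tendsto_subseq hkK
  have hpow : ∀ n : ℕ, (0 : ℝ) < 2⁻¹ ^ n := fun n => by positivity
  -- A second extraction makes the errors at most `2⁻ⁿ`, hence summable.
  obtain ⟨ψ, hψ, hψ'⟩ := extraction_forall_of_eventually' fun n : ℕ =>
    Metric.tendsto_atTop.1 hlim _ (hpow n)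
  have hπ : StrictMono (φ ∘ ψ) := hφ.comp hψ
  have hdist : ∀ n t, |k (φ (ψ n)) t - k₀ t| ≤ 2⁻¹ ^ n := by
    intro n t
    rw [← Real.dist_eq]
    exact (ContinuousMap.dist_apply_le_dist t).trans (hψ' n).le
  have hkb : PowerBounded m k₀ := powerBounded_of_mem_convexPowers hmR hk₀
  have hknn : ∀ n t, 0 ≤ k n t := fun n t => (powerBounded_of_mem_convexPowers hmR (hkK n)).1 t
  obtain ⟨hle, hge⟩ := modLE_orliczOf_of_approx hm (G := fun n => G (φ (ψ n)))
    (fun n => hG _) hkb (fun n => hGB _) (β := b * (Real.exp (-1)).toNNReal)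
    (mul_pos hb (Real.toNNReal_pos.2 (Real.exp_pos _))) (D := ENNReal.ofReal τ⁻¹)
    ENNReal.ofReal_ne_top
    (fun n t => by
      rw [hGk', ← ofReal_two_inv_pow, ← ENNReal.ofReal_add (hkb.1 t) (hpow n).le]
      refine ENNReal.ofReal_le_ofReal ?_
      have h1 := (abs_le.1 (hdist n t)).2
      have h2 := mul_le_of_le_one_left (hknn (φ (ψ n)) t) (hs1 (φ (ψ n)))
      linarith)
    (fun n t => by
      have hs0 : 0 ≤ s (φ (ψ n)) := hτ.le.trans (hτs _)
      rw [hGk', ← ofReal_two_inv_pow, ← ENNReal.ofReal_mul (inv_nonneg.2 hτ.le),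
        ← ENNReal.ofReal_add (by have := hknn (φ (ψ n)) t; positivity) (hpow n).le]
      refine ENNReal.ofReal_le_ofReal ?_
      have h1 := (abs_le.1 (hdist n t)).1
      have h2 : k (φ (ψ n)) t ≤ τ⁻¹ * (s (φ (ψ n)) * k (φ (ψ n)) t) := by
        rw [le_inv_mul_iff₀ hτ]
        exact mul_le_mul_of_nonneg_right (hτs _) (hknn _ t)
      linarith)
  exact ⟨orliczOf k₀, orliczGen_orliczOf hm hmR hk₀,
    ((hmod.comp_strictMono (fun n => (hG n).zero hm) hsub hπ).congr hle hge).eqOrliczSpace hm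
      (hkb.powerScaled hm)⟩

end SequenceSpace

/-! ### Splitting a nonatomic measure space -/

section Nonatomic

variable {Ω : Type*} [MeasurableSpace Ω] {μ : Measure Ω}

/-- Inside a subset of finite measure, repeated splitting works: of the two parts `C` and `B \ C` of
`B`, one has at most half the measure. -/
lemma IsNonatomic.exists_subset_measure_lt [SigmaFinite μ] (hμ : IsNonatomic μ) {A : Set Ω}
    (hA : MeasurableSet A) (h0 : 0 < μ A) {ε : ℝ≥0∞} (hε : ε ≠ 0) :
    ∃ B ⊆ A, MeasurableSet B ∧ 0 < μ B ∧ μ B < ε := by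
  obtain ⟨A', hA', hAA', h0', hfin⟩ := Measure.exists_subset_measure_lt_top hA h0
  have key : ∀ n : ℕ, ∃ B ⊆ A', MeasurableSet B ∧ 0 < μ B ∧ μ B ≤ μ A' * 2⁻¹ ^ n := by
    intro n
    induction n with
    | zero => exact ⟨A', subset_rfl, hA', h0', by simp⟩
    | succ n ih =>
      obtain ⟨B, hB, hBm, hB0, hBle⟩ := ih
      obtain ⟨C, hCB, hCm, hC0, hCB'⟩ := hμ B hBm hB0
      have hCfin : μ C ≠ ∞ := (hCB'.trans_le le_top).ne
      have hsum : μ (B \ C) + μ C = μ B := by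
        rw [measure_sdiff hCB hCm.nullMeasurableSet hCfin, tsub_add_cancel_of_le hCB'.le]
      have hle : μ B * 2⁻¹ ≤ μ A' * 2⁻¹ ^ (n + 1) := by
        rw [pow_succ, ← mul_assoc]
        gcongr
      have hhalf : μ B * 2⁻¹ + μ B * 2⁻¹ = μ B := by
        rw [← mul_add, ENNReal.inv_two_add_inv_two, mul_one]
      rcases le_total (μ C) (μ B * 2⁻¹) with h | h
      · exact ⟨C, hCB.trans hB, hCm, hC0, h.trans hle⟩
      · refine ⟨B \ C, Set.sdiff_subset.trans hB, hBm.diff hCm, ?_, le_trans ?_ hle⟩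
        · rw [measure_sdiff hCB hCm.nullMeasurableSet hCfin]
          exact tsub_pos_of_lt hCB'
        · by_contra! hlt
          have h1 : μ B * 2⁻¹ + μ B * 2⁻¹ < μ (B \ C) + μ C := by
            refine ENNReal.add_lt_add_of_lt_of_le ?_ hlt h
            exact ((h.trans_lt hCB').trans_le le_top).ne
          rw [hsum, hhalf] at h1
          exact lt_irrefl _ h1
  have hlim : Tendsto (fun n : ℕ => μ A' * 2⁻¹ ^ n) atTop (𝓝 0) := by
    simpa using ENNReal.Tendsto.const_mul
      (ENNReal.tendsto_pow_atTop_nhds_zero_of_lt_one (r := 2⁻¹) (by simp)) (Or.inr hfin.ne)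
  obtain ⟨n, hn⟩ := (hlim.eventually_lt_const (pos_iff_ne_zero.2 hε)).exists
  obtain ⟨B, hB, hBm, hB0, hBle⟩ := key n
  exact ⟨B, hB.trans hAA', hBm, hB0, hBle.trans_lt hn⟩

/-- Choose `B n ⊆ E n` recursively with measures decreasing by a factor of at least four. Then all
later sets together cannot exhaust `B n`, and removing them leaves disjoint sets of positive
measure. -/
lemma IsNonatomic.exists_disjoint_subsets [SigmaFinite μ] (hμ : IsNonatomic μ) {E : ℕ → Set Ω}
    (hE : ∀ i, MeasurableSet (E i)) (h0 : ∀ i, 0 < μ (E i)) :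
    ∃ D : ℕ → Set Ω, (∀ i, D i ⊆ E i) ∧ (∀ i, MeasurableSet (D i)) ∧
      Pairwise (Function.onFun Disjoint D) ∧ ∀ i, 0 < μ (D i) := by
  have hex : ∀ (n : ℕ) (ε : {ε : ℝ≥0∞ // ε ≠ 0}), ∃ B ⊆ E n, MeasurableSet B ∧ 0 < μ B ∧ μ B < ε :=
    fun n ε => hμ.exists_subset_measure_lt (hE n) (h0 n) ε.2
  choose g hgE hgm hg0 hglt using hex
  let next : ℕ → {B : Set Ω // μ B ≠ 0} → {B : Set Ω // μ B ≠ 0} := fun n B =>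
    ⟨g (n + 1) ⟨μ B.1 * (2⁻¹ * 2⁻¹), mul_ne_zero B.2 (by simp)⟩, (hg0 _ _).ne'⟩
  let B : ℕ → {B : Set Ω // μ B ≠ 0} := fun n =>
    Nat.rec ⟨g 0 ⟨1, one_ne_zero⟩, (hg0 _ _).ne'⟩ next n
  have hBsucc : ∀ n, μ (B (n + 1)).1 ≤ μ (B n).1 * (2⁻¹ * 2⁻¹) := fun n =>
    (hglt (n + 1) ⟨μ (B n).1 * (2⁻¹ * 2⁻¹), mul_ne_zero (B n).2 (by simp)⟩).le
  have hBE : ∀ n, (B n).1 ⊆ E n := by rintro (_ | n) <;> exact hgE _ _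
  have hBm : ∀ n, MeasurableSet (B n).1 := by rintro (_ | n) <;> exact hgm _ _
  have hBfin : ∀ n, μ (B n).1 ≠ ∞ := by rintro (_ | n) <;> exact (hglt _ _).ne_top
  -- The bound `4^{-(j+1)}` is weakened to `2^{-(j+2)}`, whose sum over `j` is `1/2`.
  have hdecay : ∀ k j, μ (B (k + 1 + j)).1 ≤ μ (B k).1 * (2⁻¹ * 2⁻¹ ^ (j + 1)) := by
    intro k j
    induction j with
    | zero => simpa using hBsucc k
    | succ j ih =>
      calc μ (B (k + 1 + (j + 1))).1 ≤ μ (B (k + 1 + j)).1 * (2⁻¹ * 2⁻¹) := hBsucc _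
        _ ≤ μ (B k).1 * (2⁻¹ * 2⁻¹ ^ (j + 1)) * (1 * 2⁻¹) := by
          gcongr
          simp
        _ = μ (B k).1 * (2⁻¹ * 2⁻¹ ^ (j + 1 + 1)) := by ring
  have htail : ∀ k, μ (⋃ j, (B (k + 1 + j)).1) < μ (B k).1 := by
    intro k
    calc μ (⋃ j, (B (k + 1 + j)).1) ≤ ∑' j, μ (B (k + 1 + j)).1 := measure_iUnion_le _
      _ ≤ ∑' j, μ (B k).1 * (2⁻¹ * 2⁻¹ ^ (j + 1)) := ENNReal.tsum_le_tsum (hdecay k)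
      _ = μ (B k).1 * 2⁻¹ := by
        rw [ENNReal.tsum_mul_left, ENNReal.tsum_mul_left, ENNReal.tsum_geometric_add_one,
          ENNReal.one_sub_inv_two, inv_inv, ENNReal.inv_mul_cancel (by simp) (by simp), mul_one]
      _ < μ (B k).1 := by
        rw [← div_eq_mul_inv]
        exact ENNReal.half_lt_self (B k).2 (hBfin k)
  have hUm : ∀ k, MeasurableSet (⋃ j, (B (k + 1 + j)).1) :=
    fun k => MeasurableSet.iUnion fun j => hBm _
  refine ⟨fun k => (B k).1 \ ⋃ j, (B (k + 1 + j)).1,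
    fun k => Set.sdiff_subset.trans (hBE k), fun k => (hBm k).diff (hUm k), ?_, fun k => ?_⟩
  · have hlt : ∀ i j, i < j → Disjoint ((B i).1 \ ⋃ l, (B (i + 1 + l)).1)
        ((B j).1 \ ⋃ l, (B (j + 1 + l)).1) := by
      intro i j hij
      obtain ⟨l, rfl⟩ := Nat.exists_eq_add_of_lt hij
      refine Set.disjoint_left.2 fun ω h1 h2 => h1.2 (Set.mem_iUnion.2 ⟨l, ?_⟩)
      have : i + 1 + l = i + l + 1 := by ring
      rw [this]
      exact h2.1
    intro i j hij
    rcases hij.lt_or_gt with h | h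
    · exact hlt i j h
    · exact (hlt j i h).symm
  · exact (tsub_pos_of_lt (htail k)).trans_le le_measure_sdiff

/-- A nonatomic measure space splits into countably many measurable pieces each of which meets,
in a set of positive measure, every open level set of `P` of positive measure. -/
lemma IsNonatomic.exists_partition [SigmaFinite μ] (hμ : IsNonatomic μ) {P : Ω → ℝ≥0∞}
    (hP : Measurable P) : ∃ N : Ω → ℕ, Measurable N ∧
      ∀ (n : ℕ) (V : Set ℝ≥0∞), IsOpen V → 0 < μ (P ⁻¹' V) → 0 < μ (P ⁻¹' V ∩ N ⁻¹' {n}) := by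
  set 𝒱 : Set (Set ℝ≥0∞) :=
    {V ∈ TopologicalSpace.countableBasis ℝ≥0∞ | 0 < μ (P ⁻¹' V)} with h𝒱
  have hbasis := TopologicalSpace.isBasis_countableBasis ℝ≥0∞
  have hsub : ∀ V : Set ℝ≥0∞, IsOpen V → 0 < μ (P ⁻¹' V) → ∃ U ∈ 𝒱, U ⊆ V := by
    intro V hV h0
    by_contra! hcon
    obtain ⟨𝒮, h𝒮, rfl⟩ := hbasis.open_eq_sUnion hV
    refine h0.ne' ?_
    rw [Set.preimage_sUnion, measure_biUnion_null_iff
      ((TopologicalSpace.countable_countableBasis ℝ≥0∞).mono h𝒮)]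
    intro U hU
    by_contra h
    exact hcon U ⟨h𝒮 hU, pos_iff_ne_zero.2 h⟩ (Set.subset_sUnion_of_mem hU)
  rcases 𝒱.eq_empty_or_nonempty with hempty | hne
  · refine ⟨fun _ => 0, measurable_const, fun n V hV h0 => ?_⟩
    obtain ⟨U, hU, -⟩ := hsub V hV h0
    simp [hempty] at hU
  · have hcount : 𝒱.Countable :=
      (TopologicalSpace.countable_countableBasis ℝ≥0∞).mono fun U hU => hU.1
    obtain ⟨v, hv⟩ := hcount.exists_eq_range hne
    have hvmem : ∀ j, v j ∈ 𝒱 := fun j => hv ▸ Set.mem_range_self j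
    -- Each basic set `v j` is listed once for every piece: the index `Nat.pair n j` reserves a part
    -- of `P ⁻¹' v j` for the `n`-th piece.
    obtain ⟨D, hDE, hDm, hDd, hD0⟩ := hμ.exists_disjoint_subsets
      (E := fun i => P ⁻¹' v i.unpair.2)
      (fun i => hP (hbasis.isOpen (hvmem _).1).measurableSet) (fun i => (hvmem _).2)
    obtain ⟨N, hN, hND⟩ := exists_measurable_piecewise D hDm (fun i _ => i.unpair.1)
      (fun i => measurable_const) (fun i j hij => by
        beta_reduce
        rw [(hDd hij).inter_eq]
        exact Set.eqOn_empty _ _)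
    refine ⟨N, hN, fun n V hV h0 => ?_⟩
    obtain ⟨U, hU, hUV⟩ := hsub V hV h0
    rw [hv] at hU
    obtain ⟨j, rfl⟩ := hU
    refine (hD0 (Nat.pair n j)).trans_le (measure_mono fun ω hω => ⟨hUV ?_, ?_⟩)
    · simpa using hDE _ hω
    · simpa using hND _ hω

end Nonatomic

/-! ### Approximating elements of the convex hull by means over a piece -/

section Density

variable {Ω : Type*} [MeasurableSpace Ω] {μ : Measure Ω} {P : Ω → ℝ≥0∞}

/-- Some probability density `h` on `A` satisfies `|∫_A ψ_P(t) h dμ - k(t)| ≤ ε` for all `t`. -/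
def IsApproxMean (P : Ω → ℝ≥0∞) (μ : Measure Ω) (A : Set Ω) (ε : ℝ≥0∞) (k : C(I, ℝ)) : Prop :=
  (∀ t, 0 ≤ k t) ∧ ∃ h : Ω → ℝ≥0, Measurable h ∧ ∫⁻ ω in A, h ω ∂μ = 1 ∧ ∀ t : I,
    ∫⁻ ω in A, ENNReal.ofReal (psi (P ω) t) * h ω ∂μ ≤ ENNReal.ofReal (k t) + ε ∧
    ENNReal.ofReal (k t) ≤ ∫⁻ ω in A, ENNReal.ofReal (psi (P ω) t) * h ω ∂μ + ε

lemma convex_isApproxMean (hP : Measurable P) (A : Set Ω) (ε : ℝ≥0∞) :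
    Convex ℝ {k | IsApproxMean P μ A ε k} := by
  rintro k ⟨hk0, h, hm, h1, hk⟩ l ⟨hl0, g, gm, g1, hl⟩ a b ha hb hab
  refine ⟨fun t => ?_, fun ω => a.toNNReal * h ω + b.toNNReal * g ω,
    (hm.const_mul _).add (gm.const_mul _), ?_, fun t => ?_⟩
  · simpa using add_nonneg (mul_nonneg ha (hk0 t)) (mul_nonneg hb (hl0 t))
  all_goals
    have habE : ENNReal.ofReal a + ENNReal.ofReal b = 1 := by
      rw [← ENNReal.ofReal_add ha hb, hab, ENNReal.ofReal_one]
  · simp only [ENNReal.coe_add, ENNReal.coe_mul]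
    rw [lintegral_add_left (hm.coe_nnreal_ennreal.const_mul _),
      lintegral_const_mul _ hm.coe_nnreal_ennreal, lintegral_const_mul _ gm.coe_nnreal_ennreal,
      h1, g1, mul_one, mul_one]
    exact habE
  · have hψ := (measurable_psi_comp hP t).ennreal_ofReal
    have hψh : Measurable fun ω => ENNReal.ofReal (psi (P ω) t) * (h ω : ℝ≥0∞) :=
      hψ.mul hm.coe_nnreal_ennreal
    have hψg : Measurable fun ω => ENNReal.ofReal (psi (P ω) t) * (g ω : ℝ≥0∞) :=
      hψ.mul gm.coe_nnreal_ennreal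
    have e1 : ∫⁻ ω in A, ENNReal.ofReal (psi (P ω) t) *
          ((a.toNNReal * h ω + b.toNNReal * g ω : ℝ≥0) : ℝ≥0∞) ∂μ =
        ENNReal.ofReal a * ∫⁻ ω in A, ENNReal.ofReal (psi (P ω) t) * h ω ∂μ +
        ENNReal.ofReal b * ∫⁻ ω in A, ENNReal.ofReal (psi (P ω) t) * g ω ∂μ := by
      rw [← lintegral_const_mul _ hψh, ← lintegral_const_mul _ hψg,
        ← lintegral_add_left (hψh.const_mul _)]
      refine lintegral_congr fun ω => ?_
      rw [ENNReal.coe_add, ENNReal.coe_mul, ENNReal.coe_mul, ENNReal.ofReal, ENNReal.ofReal,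
        ENNReal.ofReal]
      ring
    have e2 : ENNReal.ofReal ((a • k + b • l) t) =
        ENNReal.ofReal a * ENNReal.ofReal (k t) + ENNReal.ofReal b * ENNReal.ofReal (l t) := by
      rw [← ENNReal.ofReal_mul ha, ← ENNReal.ofReal_mul hb,
        ← ENNReal.ofReal_add (mul_nonneg ha (hk0 t)) (mul_nonneg hb (hl0 t))]
      simp
    have e3 : ε = ENNReal.ofReal a * ε + ENNReal.ofReal b * ε := by
      rw [← add_mul, habE, one_mul]
    rw [e1, e2]
    constructor
    · calc _ ≤ ENNReal.ofReal a * (ENNReal.ofReal (k t) + ε) +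
            ENNReal.ofReal b * (ENNReal.ofReal (l t) + ε) := by
            gcongr
            exacts [(hk t).1, (hl t).1]
        _ = _ := by
          conv_rhs => rw [e3]
          ring
    · calc _ ≤ ENNReal.ofReal a * (∫⁻ ω in A, ENNReal.ofReal (psi (P ω) t) * h ω ∂μ + ε) +
            ENNReal.ofReal b * (∫⁻ ω in A, ENNReal.ofReal (psi (P ω) t) * g ω ∂μ + ε) := by
            gcongr
            exacts [(hk t).2, (hl t).2]
        _ = _ := by
          conv_rhs => rw [e3]
          ring

/-- The density is the normalized indicator of a set of finite positive measure in `A` on which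
`1/P` is within `ε` of `1/p`. It exists because `p` is in the support and `A` meets each non-null
open level set. -/
lemma isApproxMean_psi [SigmaFinite μ] (hP : IsVarExponent P) {A : Set Ω} (hA : MeasurableSet A)
    (hAP : ∀ V : Set ℝ≥0∞, IsOpen V → 0 < μ (P ⁻¹' V) → 0 < μ (P ⁻¹' V ∩ A)) {p : ℝ≥0∞}
    (hp0 : 0 < p) (hp : p ∈ essRange P μ) {ε : ℝ} (hε : 0 < ε) :
    IsApproxMean P μ A (ENNReal.ofReal ε) (psi p) := by
  have hcont : ContinuousAt (fun q : ℝ≥0∞ => q⁻¹.toReal) p :=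
    (ENNReal.tendsto_toReal (ENNReal.inv_ne_top.2 hp0.ne')).comp continuous_inv.continuousAt
  obtain ⟨V, hV, hVo, hpV⟩ := mem_nhds_iff.1 (hcont (Metric.ball_mem_nhds _ hε))
  have hVpos : 0 < μ (P ⁻¹' V) := by
    have h1 := (Measure.mem_support_iff_forall p).1 hp V (hVo.mem_nhds hpV)
    rwa [Measure.map_apply hP.1 hVo.measurableSet] at h1
  obtain ⟨D, hDm, hDsub, hD0, hDfin⟩ := Measure.exists_subset_measure_lt_top
    ((hP.1 hVo.measurableSet).inter hA) (hAP V hVo hVpos)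
  have hclose : ∀ ω ∈ D, ∀ t, |psi (P ω) t - psi p t| ≤ ε := by
    intro ω hω t
    have h1 : |(P ω)⁻¹.toReal - p⁻¹.toReal| < ε := by
      have := hV (hDsub hω).1
      rwa [Set.mem_preimage, Metric.mem_ball, Real.dist_eq] at this
    exact ((psi (P ω) - psi p).norm_coe_le_norm t).trans
      ((norm_psi_sub_le (hP.2 ω) hp0).trans h1.le)
  set c : ℝ≥0 := (μ D).toNNReal⁻¹ with hc
  have hcD : (c : ℝ≥0∞) * μ D = 1 := by
    rw [hc, ENNReal.coe_inv (ENNReal.toNNReal_pos hD0.ne' hDfin.ne).ne',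
      ENNReal.coe_toNNReal hDfin.ne, ENNReal.inv_mul_cancel hD0.ne' hDfin.ne]
  have hint : ∀ u : Ω → ℝ≥0∞, ∫⁻ ω in A, u ω * (D.indicator (fun _ => c) ω : ℝ≥0) ∂μ =
      ∫⁻ ω in D, u ω * c ∂μ := by
    intro u
    have h1 : ∀ ω, u ω * (D.indicator (fun _ => c) ω : ℝ≥0) = D.indicator (fun ω => u ω * c) ω := by
      intro ω
      by_cases hω : ω ∈ D <;> simp [hω]
    simp_rw [h1]
    rw [setLIntegral_indicator hDm, Set.inter_eq_left.2 fun ω hω => (hDsub hω).2]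
  have hconst : ∀ x : ℝ≥0∞, ∫⁻ _ in D, x * c ∂μ = x := by
    intro x
    rw [setLIntegral_const, mul_assoc, hcD, mul_one]
  refine ⟨psi_nonneg p, D.indicator fun _ => c, measurable_const.indicator hDm, ?_, fun t => ?_⟩
  · have h1 := hint fun _ => 1
    simp only [one_mul] at h1
    rw [h1]
    simpa using hconst 1
  · rw [hint]
    constructor
    · calc _ ≤ ∫⁻ _ in D, (ENNReal.ofReal (psi p t) + ENNReal.ofReal ε) * c ∂μ := by
            refine setLIntegral_mono measurable_const fun ω hω => ?_
            gcongr
            rw [← ENNReal.ofReal_add (psi_nonneg p t) hε.le]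
            refine ENNReal.ofReal_le_ofReal ?_
            linarith [(abs_le.1 (hclose ω hω t)).2]
        _ = _ := hconst _
    · calc ENNReal.ofReal (psi p t) = ∫⁻ _ in D, ENNReal.ofReal (psi p t) * c ∂μ :=
            (hconst _).symm
        _ ≤ ∫⁻ ω in D, (ENNReal.ofReal (psi (P ω) t) * c + ENNReal.ofReal ε * c) ∂μ := by
            refine setLIntegral_mono' hDm fun ω hω => ?_
            rw [← add_mul]
            gcongr
            rw [← ENNReal.ofReal_add (psi_nonneg _ t) hε.le]
            refine ENNReal.ofReal_le_ofReal ?_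
            linarith [(abs_le.1 (hclose ω hω t)).1]
        _ = _ := by rw [lintegral_add_right _ measurable_const, hconst]

lemma isApproxMean_of_mem_convexPowers [SigmaFinite μ] (hP : IsVarExponent P)
    (hpos : ∀ p ∈ essRange P μ, 0 < p) {A : Set Ω} (hA : MeasurableSet A)
    (hAP : ∀ V : Set ℝ≥0∞, IsOpen V → 0 < μ (P ⁻¹' V) → 0 < μ (P ⁻¹' V ∩ A)) {k : C(I, ℝ)}
    (hk : k ∈ convexPowers (essRange P μ)) (hk0 : ∀ t, 0 ≤ k t) {ε : ℝ} (hε : 0 < ε) :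
    IsApproxMean P μ A (ENNReal.ofReal ε) k := by
  obtain ⟨l, hl, hdist⟩ := Metric.mem_closure_iff.1 hk (ε / 2) (half_pos hε)
  have hl' : IsApproxMean P μ A (ENNReal.ofReal (ε / 2)) l := by
    refine convexHull_min ?_ (convex_isApproxMean hP.1 A _) hl
    rintro _ ⟨p, hp, rfl⟩
    exact isApproxMean_psi hP hA hAP (hpos p hp) hp (half_pos hε)
  obtain ⟨hl0, h, hm, h1, hh⟩ := hl'
  have hkl : ∀ t, |k t - l t| ≤ ε / 2 := fun t => by
    rw [← Real.dist_eq]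
    exact (ContinuousMap.dist_apply_le_dist t).trans hdist.le
  have hsplit : ENNReal.ofReal ε = ENNReal.ofReal (ε / 2) + ENNReal.ofReal (ε / 2) := by
    rw [← ENNReal.ofReal_add (half_pos hε).le (half_pos hε).le, add_halves]
  refine ⟨hk0, h, hm, h1, fun t => ⟨(hh t).1.trans ?_, ?_⟩⟩
  · rw [hsplit, ← add_assoc]
    gcongr
    rw [← ENNReal.ofReal_add (hk0 t) (half_pos hε).le]
    exact ENNReal.ofReal_le_ofReal (by linarith [(abs_le.1 (hkl t)).1])
  · have h2 : ENNReal.ofReal (k t) ≤ ENNReal.ofReal (l t) + ENNReal.ofReal (ε / 2) := by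
      rw [← ENNReal.ofReal_add (hl0 t) (half_pos hε).le]
      exact ENNReal.ofReal_le_ofReal (by linarith [(abs_le.1 (hkl t)).2])
    refine h2.trans ?_
    rw [hsplit, ← add_assoc]
    gcongr
    exact (hh t).2

end Density

/-! ### Functions with prescribed modular -/

section Root

variable {Ω : Type*} [MeasurableSpace Ω] {μ : Measure Ω} {P : Ω → ℝ≥0∞}

/-- The function `g` with `Φ_P(t g) = ψ_P(t) h` for `t ∈ [0,1]`. -/
noncomputable def expRoot (P : Ω → ℝ≥0∞) (h : Ω → ℝ≥0) (ω : Ω) : ℝ≥0 :=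
  if P ω = ∞ then (if h ω = 0 then 0 else 1)
  else (h ω / (P ω).toNNReal) ^ ((P ω).toReal)⁻¹

lemma measurable_expRoot (hP : Measurable P) {h : Ω → ℝ≥0} (hh : Measurable h) :
    Measurable (expRoot P h) := by
  refine Measurable.ite (hP (measurableSet_singleton _)) ?_ ?_
  · exact Measurable.ite (hh (measurableSet_singleton _)) measurable_const measurable_const
  · exact (hh.div hP.ennreal_toNNReal).pow hP.ennreal_toReal.inv

lemma powerFn_mul_expRoot {Ω : Type*} {P : Ω → ℝ≥0∞} {h : Ω → ℝ≥0} {ω : Ω} (hp : 0 < P ω) (hne : P ω ≠ ∞) (t : ℝ≥0) :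
    powerFn (P ω) (t * expRoot P h ω) =
      ENNReal.ofReal ((t : ℝ) ^ (P ω).toReal / (P ω).toReal) * h ω := by
  have hp' : 0 < (P ω).toReal := ENNReal.toReal_pos hp.ne' hne
  rw [powerFn_of_ne_top hne, expRoot, if_neg hne, ← ENNReal.coe_rpow_of_nonneg _ hp'.le,
    NNReal.mul_rpow, ← NNReal.rpow_mul, inv_mul_cancel₀ hp'.ne', NNReal.rpow_one, ENNReal.ofReal,
    ← ENNReal.coe_mul, ENNReal.coe_inj]
  ext
  rw [NNReal.coe_mul, NNReal.coe_mul, NNReal.coe_rpow, NNReal.coe_div, ENNReal.coe_toNNReal_eq_toReal,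
    Real.coe_toNNReal _ (by positivity)]
  ring

lemma powerFn_mul_expRoot_toNNReal {Ω : Type*} {P : Ω → ℝ≥0∞} (hP : ∀ ω, 0 < P ω) (h : Ω → ℝ≥0) (t : I) (ω : Ω) :
    powerFn (P ω) (unitInterval.toNNReal t * expRoot P h ω) =
      ENNReal.ofReal (psi (P ω) t) * h ω := by
  by_cases hne : P ω = ∞
  · have h1 : unitInterval.toNNReal t * expRoot P h ω ≤ 1 := by
      refine mul_le_one₀ t.2.2 zero_le ?_
      rw [expRoot, if_pos hne]
      split_ifs <;> simp
    rw [hne, powerFn_top, if_pos h1, psi_top, ENNReal.ofReal_zero, zero_mul]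
  · rw [powerFn_mul_expRoot (hP ω) hne, psi_of_ne_top hne, unitInterval.coe_toNNReal]

/-- `e^{2p} ≥ 2p + 1` gives `e^{2p}/p ≥ 2` for all `p`. Thus the dilation `e²` brings the modular
above `1` uniformly, even where `ψ_p` is tiny or zero. -/
lemma two_mul_le_powerFn_expRoot {Ω : Type*} {P : Ω → ℝ≥0∞} (hP : ∀ ω, 0 < P ω) (h : Ω → ℝ≥0) (ω : Ω) :
    2 * (h ω : ℝ≥0∞) ≤ powerFn (P ω) ((Real.exp 2).toNNReal * expRoot P h ω) := by
  by_cases hne : P ω = ∞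
  · rw [hne, powerFn_top, expRoot, if_pos hne]
    by_cases h0 : h ω = 0
    · simp [h0]
    · have h1 : ¬ (Real.exp 2).toNNReal ≤ 1 := by simp
      simp [h0, h1]
  · have hp' : 0 < (P ω).toReal := ENNReal.toReal_pos (hP ω).ne' hne
    rw [powerFn_mul_expRoot (hP ω) hne]
    gcongr
    rw [← ENNReal.ofReal_ofNat]
    refine ENNReal.ofReal_le_ofReal ?_
    rw [Real.coe_toNNReal _ (Real.exp_pos _).le, ← Real.exp_mul, le_div_iff₀ hp']
    linarith [Real.add_one_le_exp (2 * (P ω).toReal)]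

/-- There are a function `g` and a partition `{N = n}` of `Ω` such that the modulars of the
restrictions of `g` to the pieces are close to `k` near zero. -/
lemma exists_dilatedModular_approx [SigmaFinite μ] (hμ : IsNonatomic μ) (hP : IsVarExponent P)
    (hpos : ∀ p ∈ essRange P μ, 0 < p) {k : C(I, ℝ)} (hk : k ∈ convexPowers (essRange P μ))
    (hk0 : ∀ t, 0 ≤ k t) :
    ∃ (N : Ω → ℕ) (g : Ω → ℝ≥0), Measurable N ∧ Measurable g ∧ ∀ n : ℕ,
      1 < dilatedModular P (μ.restrict (N ⁻¹' {n})) g (Real.exp 2).toNNReal ∧ ∀ t : I,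
      dilatedModular P (μ.restrict (N ⁻¹' {n})) g (unitInterval.toNNReal t) ≤
        ENNReal.ofReal (k t) + 2⁻¹ ^ n ∧
      ENNReal.ofReal (k t) ≤
        dilatedModular P (μ.restrict (N ⁻¹' {n})) g (unitInterval.toNNReal t) + 2⁻¹ ^ n := by
  obtain ⟨N, hN, hNP⟩ := hμ.exists_partition hP.1
  have hNm : ∀ n, MeasurableSet (N ⁻¹' {n}) := fun n => hN (measurableSet_singleton n)
  have happ : ∀ n : ℕ, IsApproxMean P μ (N ⁻¹' {n}) (ENNReal.ofReal (2⁻¹ ^ n)) k := fun n =>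
    isApproxMean_of_mem_convexPowers hP hpos (hNm n) (hNP n) hk hk0 (by positivity)
  choose _ h hm h1 hh using happ
  obtain ⟨H, hH, hHN⟩ := exists_measurable_piecewise (fun n => N ⁻¹' {n}) hNm h hm
    fun i j hij => by
      beta_reduce
      rintro ω ⟨rfl, h2⟩
      exact absurd h2 hij
  have heq : ∀ n t, dilatedModular P (μ.restrict (N ⁻¹' {n})) (expRoot P H)
      (unitInterval.toNNReal t) =
        ∫⁻ ω in N ⁻¹' {n}, ENNReal.ofReal (psi (P ω) t) * h n ω ∂μ := by
    intro n t
    refine setLIntegral_congr_fun (hNm n) fun ω hω => ?_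
    rw [← hHN n hω]
    exact powerFn_mul_expRoot_toNNReal hP.2 H t ω
  refine ⟨N, expRoot P H, hN, measurable_expRoot hP.1 hH, fun n => ⟨?_, fun t => ?_⟩⟩
  · calc (1 : ℝ≥0∞) < 2 * ∫⁻ ω in N ⁻¹' {n}, h n ω ∂μ := by rw [h1]; norm_num
      _ = ∫⁻ ω in N ⁻¹' {n}, 2 * (H ω : ℝ≥0∞) ∂μ := by
        rw [← lintegral_const_mul _ (hm n).coe_nnreal_ennreal]
        exact setLIntegral_congr_fun (hNm n) fun ω hω => by rw [hHN n hω]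
      _ ≤ _ := lintegral_mono fun ω => two_mul_le_powerFn_expRoot hP.2 H ω
  · rw [heq, ← ofReal_two_inv_pow]
    exact hh n t

end Root

/-! ### From an Orlicz sequence space to a disjoint embedding -/

namespace SequenceSpace

variable {𝕜 : Type*} [RCLike 𝕜] {S : SequenceSpace 𝕜}
  {Ω : Type*} [MeasurableSpace Ω] {μ : Measure Ω} {P : Ω → ℝ≥0∞}

lemma stronglyMeasurable_comp_mul (a : ℕ → 𝕜) {N : Ω → ℕ} {g : Ω → ℝ≥0} (hN : Measurable N)
    (hg : Measurable g) : StronglyMeasurable fun ω => a (N ω) * ((g ω : ℝ) : 𝕜) :=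
  (((measurable_from_nat (f := a)).comp hN).mul
    (RCLike.measurable_ofReal.comp hg.coe_nnreal_real)).stronglyMeasurable

/-- The map that sends `a` to the function equal to `a n • g` on `{N = n}`. -/
noncomputable def spread (S : SequenceSpace 𝕜) (μ : Measure Ω) {N : Ω → ℕ} {g : Ω → ℝ≥0}
    (hN : Measurable N) (hg : Measurable g) : S.carrier →ₗ[𝕜] (Ω →ₘ[μ] 𝕜) where
  toFun a := AEEqFun.mk (fun ω => (a : ℕ → 𝕜) (N ω) * ((g ω : ℝ) : 𝕜))
    (stronglyMeasurable_comp_mul _ hN hg).aestronglyMeasurable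
  map_add' a b := by
    rw [AEEqFun.mk_add_mk]
    congr 1
    ext ω
    simp [add_mul]
  map_smul' c a := by
    rw [RingHom.id_apply, AEEqFun.smul_mk]
    congr 1
    ext ω
    simp [mul_assoc]

lemma coeFn_spread {N : Ω → ℕ} {g : Ω → ℝ≥0} (hN : Measurable N) (hg : Measurable g)
    (a : S.carrier) :
    ∀ᵐ ω ∂μ, S.spread μ hN hg a ω = (a : ℕ → 𝕜) (N ω) * ((g ω : ℝ) : 𝕜) :=
  AEEqFun.coeFn_mk _ _

lemma modular_spread {N : Ω → ℕ} {g : Ω → ℝ≥0} (hN : Measurable N) (hg : Measurable g)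
    (a : S.carrier) (r : ℝ≥0) :
    modular (expMO P) μ (fun ω => r * ‖S.spread μ hN hg a ω‖₊) =
      ∑' n, dilatedModular P (μ.restrict (N ⁻¹' {n})) g (r * ‖(a : ℕ → 𝕜) n‖₊) := by
  have hNm : ∀ n, MeasurableSet (N ⁻¹' {n}) := fun n => hN (measurableSet_singleton n)
  have hdisj : Pairwise (Function.onFun Disjoint fun n => N ⁻¹' {n}) := fun i j hij =>
    Set.disjoint_left.2 fun ω h1 h2 => hij (h1.symm.trans h2)
  have huniv : (⋃ n, N ⁻¹' {n}) = Set.univ := Set.eq_univ_of_forall fun ω => by simp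
  rw [modular]
  have h1 : ∫⁻ ω, expMO P ω (r * ‖S.spread μ hN hg a ω‖₊) ∂μ =
      ∫⁻ ω, expMO P ω (r * ‖(a : ℕ → 𝕜) (N ω)‖₊ * g ω) ∂μ := by
    refine lintegral_congr_ae ?_
    filter_upwards [coeFn_spread hN hg a] with ω hω
    rw [hω, nnnorm_mul, nnnorm_coe_nnreal, mul_assoc]
  rw [h1, ← setLIntegral_univ, ← huniv, lintegral_iUnion hNm hdisj]
  refine tsum_congr fun n => setLIntegral_congr_fun (hNm n) fun ω hω => ?_
  have hn : N ω = n := hω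
  simp only [hn]

lemma le_mul_luxemburg {M : Ω → ℝ≥0 → ℝ≥0∞} {f : Ω → 𝕜} {x C : ℝ≥0} (hC : 0 < C)
    (h : ∀ t : ℝ≥0, 0 < t → modular M μ (fun ω => ‖f ω‖₊ / t) < 1 → x ≤ C * t) :
    (x : ℝ≥0∞) ≤ C * luxemburg M μ f := by
  have hC0 : (C : ℝ≥0∞) ≠ 0 := by exact_mod_cast hC.ne'
  rw [mul_comm, ← ENNReal.div_le_iff hC0 ENNReal.coe_ne_top]
  refine le_iInf fun t => le_iInf fun ht => le_iInf fun hlt => ?_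
  rw [ENNReal.div_le_iff hC0 ENNReal.coe_ne_top, mul_comm]
  exact_mod_cast h t ht hlt

lemma IsModular.disjointlyEmbeds {m : ℝ} (hm : 0 < m)
    (hmP : ∀ᵐ ω ∂μ, ENNReal.ofReal m ≤ P ω) {N : Ω → ℕ} {g : Ω → ℝ≥0} (hN : Measurable N)
    (hg : Measurable g)
    (hS : S.IsModular fun n => dilatedModular P (μ.restrict (N ⁻¹' {n})) g) :
    S.DisjointlyEmbeds μ P := by
  obtain ⟨⟨c, hc, hc'⟩, C, hC, hC'⟩ := hS
  obtain ⟨s, hs0, hs1, hs⟩ := exists_rpow_mul_lt hm ENNReal.one_ne_top one_ne_zero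
  have hsc : 0 < s * c := mul_pos hs0 hc
  have hscale : ∀ n, PowerScaled m (dilatedModular P (μ.restrict (N ⁻¹' {n})) g) := fun n =>
    powerScaled_dilatedModular hm (ae_restrict_of_ae hmP) g
  have hunit : ∀ a : S.carrier, S.nrm a ≤ 1 →
      modular (expMO P) μ (fun ω => s * c * ‖S.spread μ hN hg a ω‖₊) < 1 := by
    intro a ha
    rw [modular_spread]
    simp_rw [mul_assoc]
    refine (tsum_mul_le_of_powerScaled hscale hs1 _).trans_lt (lt_of_le_of_lt ?_ hs)
    gcongr
    exact hc' a ha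
  have hsmall : ∀ (a : S.carrier) (r : ℝ≥0), 0 < r → S.nrm a ≤ r →
      modular (expMO P) μ (fun ω => s * c * r⁻¹ * ‖S.spread μ hN hg a ω‖₊) < 1 := by
    intro a r hr ha
    have h1 := hunit ((((r⁻¹ : ℝ≥0) : ℝ) : 𝕜) • a) (by
      rw [nrm_smul_nnreal]
      exact (inv_mul_le_one₀ hr).2 ha)
    rw [modular_spread] at h1 ⊢
    simpa only [nnnorm_smul_apply, mul_assoc] using h1
  refine ⟨S.spread μ hN hg, fun a => ?_, ⟨(s * c)⁻¹ + C, fun a => ⟨?_, ?_⟩⟩, fun i j hij => ?_⟩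
  · exact ⟨s * c * (S.nrm a + 1)⁻¹, by positivity,
      (hsmall a _ (by positivity) le_self_add).trans ENNReal.one_lt_top⟩
  -- The norm of `a` may be zero, so the bound is proved for `r` above it and then passed to the
  -- limit.
  · have h1 : ∀ r : ℝ≥0, S.nrm a < r →
        luxemburg (expMO P) μ (S.spread μ hN hg a) ≤ ((s * c)⁻¹ * r : ℝ≥0) := by
      intro r hr
      have hr0 : 0 < r := pos_of_gt hr
      refine luxemburg_le (by positivity) ?_
      have h2 := hsmall a r hr0 hr.le
      simpa only [div_eq_inv_mul, mul_inv, inv_inv] using h2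
    have hsc' : ((s * c)⁻¹ : ℝ≥0) ≠ 0 := (inv_pos.2 hsc).ne'
    have hne : luxemburg (expMO P) μ (S.spread μ hN hg a) ≠ ∞ :=
      ((h1 (S.nrm a + 1) (by simp)).trans_lt ENNReal.coe_lt_top).ne
    have hx := ENNReal.coe_toNNReal hne
    set x := (luxemburg (expMO P) μ (S.spread μ hN hg a)).toNNReal
    rw [← hx] at h1 ⊢
    have h3 : x ≤ (s * c)⁻¹ * S.nrm a := by
      rw [le_inv_mul_iff₀ hsc]
      refine le_of_forall_gt_imp_ge_of_dense fun r hr => ?_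
      have h4 := ENNReal.coe_le_coe.1 (h1 r hr)
      rwa [le_inv_mul_iff₀ hsc] at h4
    exact_mod_cast h3.trans (mul_le_mul_left le_self_add _)
  · refine le_mul_luxemburg (by positivity) fun t ht hlt => ?_
    have h1 : modular (expMO P) μ (fun ω => t⁻¹ * ‖S.spread μ hN hg a ω‖₊) < 1 := by
      simpa only [div_eq_inv_mul] using hlt
    rw [modular_spread] at h1
    obtain ⟨h2, h3⟩ := mem_of_smul_mem (r := C) (a := (a : ℕ → 𝕜)) (inv_pos.2 ht) (hC' _ (by
      simpa only [Pi.smul_apply, smul_eq_mul, nnnorm_mul, nnnorm_coe_nnreal] using h1.le))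
    rw [inv_inv, mul_comm] at h3
    exact h3.trans (mul_le_mul_left le_add_self _)
  · filter_upwards [coeFn_spread hN hg (S.unitVec i), coeFn_spread hN hg (S.unitVec j)]
      with ω h1 h2
    rw [h1, h2]
    by_cases h : N ω = i
    · right
      have : N ω ≠ j := h ▸ hij
      simp [unitVec, this]
    · left
      simp [unitVec, h]

theorem EqOrliczSpace.disjointlyEmbeds [SigmaFinite μ] (hμ : IsNonatomic μ)
    (hP : IsVarExponent P) (hPpos : 0 < expMinus P μ) {F : ℝ≥0 → ℝ≥0∞}
    (hF : OrliczGen (essRange P μ) F) (hS : S.EqOrliczSpace F) : S.DisjointlyEmbeds μ P := by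
  obtain ⟨m, hm, hmP⟩ := exists_pos_le_expMinus hPpos
  have hmR : ∀ p ∈ essRange P μ, ENNReal.ofReal m ≤ p := fun p hp => hmP.trans (sInf_le hp)
  have hmae : ∀ᵐ ω ∂μ, ENNReal.ofReal m ≤ P ω := by
    filter_upwards [ae_mem_essRange hP.1] with ω hω using hmR _ hω
  obtain ⟨hFO, c, hc, -, k, hk, A, B, hA, -, hFk⟩ := hF
  have hkb := powerBounded_of_mem_convexPowers hmR hk
  obtain ⟨N, g, hN, hg, happ⟩ := exists_dilatedModular_approx hμ hP
    (fun p hp => (ENNReal.ofReal_pos.2 hm).trans_le (hmR p hp)) hk hkb.1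
  obtain ⟨h1, h2⟩ := modLE_orliczOf_of_approx hm
    (G := fun n => dilatedModular P (μ.restrict (N ⁻¹' {n})) g)
    (fun n => powerScaled_dilatedModular hm (ae_restrict_of_ae hmae) g) hkb
    (fun n => (happ n).1) one_pos ENNReal.one_ne_top
    (fun n t => by simpa using ((happ n).2 t).1) (fun n t => by simpa using ((happ n).2 t).2)
  exact ((hS.isModular hm hFO hkb hc hA hFk).congr h2 h1).disjointlyEmbeds hm hmae hN hg

end SequenceSpace

end VarExp

theorem mainTheorem6 {𝕜 : Type*} [RCLike 𝕜] {Ω : Type*} [MeasurableSpace Ω]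
    (μ : Measure Ω) [SigmaFinite μ] (hμ : VarExp.IsNonatomic μ)
    (P : Ω → ℝ≥0∞) (hP : VarExp.IsVarExponent P) (hPpos : 0 < VarExp.expMinus P μ)
    (S : VarExp.SequenceSpace 𝕜) (hS : S.IsSubsymmetric) :
    S.DisjointlyEmbeds μ P ↔
      ∃ F : ℝ≥0 → ℝ≥0∞, VarExp.OrliczGen (VarExp.essRange P μ) F ∧ S.EqOrliczSpace F := by
  constructor
  · exact fun h => h.exists_eqOrliczSpace hP hPpos hS
  · rintro ⟨F, hF, h⟩
    exact h.disjointlyEmbeds hμ hP hPpos hF
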